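/- Let $p\in(1,\infty)$, $K\le 0$, $N>1$, $D>0$ and $\kappa=K/(N-1)$. Set $s_\kappa(\theta)=\theta$ if $\kappa=0$ and $s_\kappa(\theta)=\sinh(\sqrt{-\kappa}\,\theta)/\sqrt{-\kappa}$ if $\kappa<0$; for $t\in[0,1]$ and $\theta\ge 0$ set $\sigma^{(t)}_\kappa(\theta)=s_\kappa(t\theta)/s_\kappa(\theta)$ if $\theta>0$ and $\sigma^{(t)}_\kappa(0)=t$. Let $\mathcal F_{K,N,D}$ be the set of non-negative integrable Borel functions $h$ on $\mathbb R$ with $\operatorname{supp}h=[0,D]$ (the closure of $\{h\ne0\}$) that are MCP$(K,N)$ densities, i.e. $$h(tx_1+(1-t)x_0)\ \ge\ \sigma^{(1-t)}_\kappa(|x_1-x_0|)^{N-1}\,h(x_0)\qquad\text{for all }x_0,x_1\in[0,D],\ t\in[0,1].$$ For $h\in\mathcal F_{K,N,D}$ the $p$-spectral gap is $$\lambda^{p,h}=\inf\left\{\frac{\int|u'|^p h\,dx}{\int|u|^p h\,dx}:\ u\ \text{Lipschitz},\ u\in L^p(h\,dx),\ \int u|u|^{p-2}h\,dx=0,\ u\not\equiv0\text{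 on }[0,D]\right\}.$$ The model density is $h_{K,N,D}(x)=s_\kappa(D-x)^{N-1}$ for $x\in[0,D/2]$ and $h_{K,N,D}(x)=s_\kappa(x)^{N-1}$ for $x\in[D/2,D]$, and $T_{K,N,D}=(\ln h_{K,N,D})'$; that is, $T_{K,N,D}(x)=c(x)$ for $x\in[D/2,D]$ and $T_{K,N,D}(x)=-c(D-x)$ for $x\in[0,D/2)$, where $c(x)=(N-1)/x$ if $K=0$ and $c(x)=\sqrt{-K(N-1)}\coth(\sqrt{-K/(N-1)}\,x)$ if $K<0$. Let $\pi_p=\int_{-1}^1(1-|t|^p)^{-1/p}\,dt$, let $\sin_p$ be the inverse of $y\mapsto\int_0^y(1-|s|^p)^{-1/p}\,ds$, $y\in[-1,1]$, on $[-\pi_p/2,\pi_p/2]$, extended by $\sin_p(t)=\sin_p(\pi_p-t)$ to $[-\pi_p/2,3\pi_p/2]$ and then $2\pi_p$-periodically, and let $\cos_p=\sin_p'$. Let $\hat\lambda^p_{K,N,D}$ be the minimal $\lambda\ge0$ for which there is a function $\varphi$ on $[0,D]$ with $$\varphi'=\Big(\frac{\lambda}{p-1}\Big)^{1/p}+\frac1{p-1}\,T_{K,N,D}\,|\cos_p(\varphi)|^{p-2}\cos_p(\varphi)\,\sin_p(\varphi)\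 \text{ on }[0,D],\qquad \varphi(0)=-\frac{\pi_p}2,\quad \varphi\Big(\frac D2\Big)=0,\quad \varphi(D)=\frac{\pi_p}2 .$$ If $h\in\mathcal F_{K,N,D}$ satisfies $\lambda^{p,h}=\hat\lambda^p_{K,N,D}$, then there is a constant $c>0$ such that $h(x)=c\,h_{K,N,D}(x)$ for all $x\in(0,D)$. -/

import Mathlib

open MeasureTheory Set

namespace MCPGap

/-- The function `s_κ` for a parameter `κ ≤ 0` (only this range is used):
`s_0(θ) = θ` and `s_κ(θ) = sinh(√(-κ) θ) / √(-κ)` for `κ < 0`. -/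
noncomputable def sK (κ θ : ℝ) : ℝ :=
  if κ = 0 then θ else Real.sinh (Real.sqrt (-κ) * θ) / Real.sqrt (-κ)

/-- The distortion coefficient `σ^{(t)}(θ)` with curvature parameter `κ ≤ 0`:
it is `t` if `κ θ² = 0`, and `sinh(t θ √(-κ)) / sinh(θ √(-κ))` if `κ θ² < 0`. -/
noncomputable def distortion (κ t θ : ℝ) : ℝ :=
  if κ * θ ^ 2 = 0 then t
  else Real.sinh (t * θ * Real.sqrt (-κ)) / Real.sinh (θ * Real.sqrt (-κ))

/-- One-dimensional `MCP(K, N)` densities for `K ≤ 0`, `N > 1`: nonnegative integrable Borel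
functions satisfying the contraction inequality between any two points of the support. A density
on the half line is regarded as a function on `ℝ`. -/
structure IsMCPDensity (K N : ℝ) (h : ℝ → ℝ) : Prop where
  measurable : Measurable h
  nonneg : ∀ x, 0 ≤ h x
  integrable : Integrable h
  contraction : ∀ x₀ ∈ tsupport h, ∀ x₁ ∈ tsupport h, ∀ t ∈ Icc (0 : ℝ) 1,
    distortion (K / (N - 1)) (1 - t) |x₁ - x₀| ^ (N - 1) * h x₀ ≤ h (t * x₁ + (1 - t) * x₀)

/-- The class `F_{K,N,D}` for `K ≤ 0`: the `MCP(K, N)` densities with support `[0, D]`. -/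
def densityClass (K N D : ℝ) : Set (ℝ → ℝ) :=
  {h | IsMCPDensity K N h ∧ tsupport h = Icc 0 D}

/-- The `p`-spectral gap `λ^{p,h}`: the infimum of `∫ |u'|^p h / ∫ |u|^p h` over the Lipschitz
functions `u` in `L^p(h)` with `∫ u |u|^{p-2} h = 0` that do not vanish identically on the
support of `h`. -/
noncomputable def spectralGap (p : ℝ) (h : ℝ → ℝ) : ℝ :=
  sInf {r | ∃ u : ℝ → ℝ, (∃ C, LipschitzWith C u) ∧
    Integrable (fun x => |u x| ^ p * h x) ∧
    ∫ x, u x * |u x| ^ (p - 2) * h x = 0 ∧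
    (∃ x ∈ tsupport h, u x ≠ 0) ∧
    r = (∫ x, |deriv u x| ^ p * h x) / ∫ x, |u x| ^ p * h x}

/-- The model density `h_{K,N,D}` on `[0, D]`, extended by zero. -/
noncomputable def modelDensity (K N D x : ℝ) : ℝ :=
  if 0 ≤ x ∧ x ≤ D / 2 then sK (K / (N - 1)) (D - x) ^ (N - 1)
  else if D / 2 ≤ x ∧ x ≤ D then sK (K / (N - 1)) x ^ (N - 1)
  else 0

/-- The logarithmic derivative of `s_{K/(N-1)}^{N-1}`, for `K ≤ 0`. -/
noncomputable def cotKN (K N x : ℝ) : ℝ :=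
  if K = 0 then (N - 1) / x
  else Real.sqrt (-K * (N - 1)) *
    (Real.cosh (Real.sqrt (-K / (N - 1)) * x) / Real.sinh (Real.sqrt (-K / (N - 1)) * x))

/-- The logarithmic derivative `T_{K,N,D}` of the model density (its value at `D / 2`, where the
model density has a corner, plays no role). -/
noncomputable def modelT (K N D x : ℝ) : ℝ :=
  if D / 2 ≤ x then cotKN K N x else -cotKN K N (D - x)

/-- `π_p = ∫_{-1}^{1} (1 - |t|^p)^{-1/p} dt`. -/
noncomputable def piP (p : ℝ) : ℝ :=
  ∫ t in (-1 : ℝ)..1, 1 / (1 - |t| ^ p) ^ (1 / p)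

/-- The function `y ↦ ∫_0^y (1 - |s|^p)^{-1/p} ds`, a bijection of `[-1, 1]` onto
`[-π_p/2, π_p/2]`. -/
noncomputable def arcsinP (p y : ℝ) : ℝ :=
  ∫ s in (0 : ℝ)..y, 1 / (1 - |s| ^ p) ^ (1 / p)

/-- `t` reduced modulo `2 π_p` to the interval `[-π_p/2, 3π_p/2)`. -/
noncomputable def reduceP (p t : ℝ) : ℝ :=
  t - 2 * piP p * (⌊(t + piP p / 2) / (2 * piP p)⌋ : ℝ)

/-- The generalized sine: the inverse of `arcsinP p` on `[-π_p/2, π_p/2]`, extended by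
`sin_p t = sin_p (π_p - t)` to `[-π_p/2, 3π_p/2]` and then `2 π_p`-periodically. -/
noncomputable def sinP (p t : ℝ) : ℝ :=
  if reduceP p t ≤ piP p / 2 then
    Function.invFunOn (arcsinP p) (Icc (-1) 1) (reduceP p t)
  else
    Function.invFunOn (arcsinP p) (Icc (-1) 1) (piP p - reduceP p t)

/-- The generalized cosine: the derivative of the generalized sine. -/
noncomputable def cosP (p t : ℝ) : ℝ := deriv (sinP p) t

/-- `φ` solves, on `[0, D]`,
`φ' = (λ/(p-1))^{1/p} + (1/(p-1)) T_{K,N,D} |cos_p φ|^{p-2} cos_p φ sin_p φ`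
with `φ(0) = -π_p/2`, `φ(D/2) = 0`, `φ(D) = π_p/2`. Here `|c|^{p-2} c` is `c^{p-1}` for `c ≥ 0`. -/
structure IsPruferSolution (p K N D lam : ℝ) (φ : ℝ → ℝ) : Prop where
  ode : ∀ x ∈ Icc (0 : ℝ) D, HasDerivWithinAt φ
    ((lam / (p - 1)) ^ (1 / p) + 1 / (p - 1) * modelT K N D x *
      (|cosP p (φ x)| ^ (p - 2) * cosP p (φ x)) * sinP p (φ x)) (Icc 0 D) x
  left : φ 0 = -(piP p / 2)
  mid : φ (D / 2) = 0
  right : φ D = piP p / 2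

/-- The number `\hat λ^p_{K,N,D}`: the least `λ ≥ 0` for which the boundary value problem for the
model density is solvable. -/
noncomputable def modelGap (p K N D : ℝ) : ℝ :=
  sInf {lam | 0 ≤ lam ∧ ∃ φ : ℝ → ℝ, IsPruferSolution p K N D lam φ}

end MCPGap

/-!
The model density is symmetric, so half of it, `m(x) = s_κ(D - x)^{N-1}` on `[0, D/2]`, carries all
the information: a Prüfer angle found by shooting yields `λ > 0` together with a positive solution
`f` of `(m |f'|^{p-2} f')' = -λ m f^{p-1}`, `f'(0) = 0`, `f(D/2) = 0`, and `λ` is at least the model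
gap.

If `k` is an MCP density then `k / m` is nondecreasing, so the averaged flux
`(1 / k(s)) ∫_0^s k f^{p-1}` of `k` is at most that of `m`. With the slope `-f'` recomputed from the
flux of `k` as Schur weight, the weighted Hardy inequality
`λ ∫_0^a |u|^p k ≤ ∫_0^a |u'|^p k`, `u(a) = 0`, follows for every `a ≤ D/2`, and its constant can be
improved if `a < D/2` or if `k / m` is not constant.

If `k / m` is not constant on the left half, the improved constant at `a = D/2` survives, by
dilation, at some `a > D/2`, while `[a, D]` is shorter than a half interval. So both sides of `a`
have a constant `μ > λ`. Applying the inequalities to `u - u(a)`, where by convexity subtracting a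
constant does not decrease `∫ |u|^p k` when `∫ u |u|^{p-2} k = 0`, gives `λ^{p,k} ≥ μ > λ`. Hence
equality of the gaps forces `k / m` to be constant, and by reflection the same holds on the right
half.
-/

namespace MCPGap

/-! ### Generalized trigonometric functions -/

section Trigonometry

variable {p s t x y : ℝ}

/-- The integrand `(1 - |s|^p)^{-1/p}` of `arcsinP` and `piP`; its junk value `0` at `s = ±1` does
not affect the integrals. -/
noncomputable def arcsinDeriv (p s : ℝ) : ℝ := 1 / (1 - |s| ^ p) ^ (1 / p)

/-- The interval `[-π_p/2, π_p/2]`, on which `sin_p` is the inverse of `arcsinP p`. -/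
abbrev principalBranch (p : ℝ) : Set ℝ := Icc (-(piP p / 2)) (piP p / 2)

lemma abs_rpow_lt_one (hp : 0 < p) (hs : s ∈ Ioo (-1 : ℝ) 1) : |s| ^ p < 1 :=
  Real.rpow_lt_one (abs_nonneg s) (abs_lt.2 hs) hp

lemma one_le_arcsinDeriv (hp : 0 < p) (hs : s ∈ Ioo (-1 : ℝ) 1) : 1 ≤ arcsinDeriv p s := by
  have hlt := abs_rpow_lt_one hp hs
  have hnonneg : 0 ≤ |s| ^ p := by positivity
  rw [arcsinDeriv, le_div_iff₀ (Real.rpow_pos_of_pos (by linarith) _), one_mul]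
  exact Real.rpow_le_one (by linarith) (by linarith) (by positivity)

lemma measurable_arcsinDeriv (p : ℝ) : Measurable (arcsinDeriv p) := by
  unfold arcsinDeriv
  fun_prop

lemma arcsinDeriv_neg (p s : ℝ) : arcsinDeriv p (-s) = arcsinDeriv p s := by
  simp only [arcsinDeriv, abs_neg]

lemma norm_arcsinDeriv_le (hp : 1 < p) (hs : s ∈ Ioc (0 : ℝ) 1) :
    ‖arcsinDeriv p s‖ ≤ ‖(1 - s) ^ (-(1 / p))‖ := by
  have hpow : s ^ p ≤ s := by
    simpa using Real.rpow_le_rpow_of_exponent_ge hs.1 hs.2 hp.le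
  have hbase : 0 ≤ 1 - s := sub_nonneg.2 hs.2
  have hroot := Real.rpow_nonneg (by linarith : 0 ≤ 1 - s ^ p) (1 / p)
  rw [arcsinDeriv, abs_of_pos hs.1, Real.norm_of_nonneg (by positivity),
    Real.norm_of_nonneg (by positivity), Real.rpow_neg hbase, one_div]
  rcases hs.2.eq_or_lt with rfl | hlt
  · simp
  · exact inv_anti₀ (Real.rpow_pos_of_pos (by linarith) _)
      (Real.rpow_le_rpow hbase (by linarith) (by positivity))

lemma intervalIntegrable_arcsinDeriv (hp : 1 < p) (hx : x ∈ Icc (-1 : ℝ) 1)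
    (hy : y ∈ Icc (-1 : ℝ) 1) : IntervalIntegrable (arcsinDeriv p) volume x y := by
  have hmajorant : IntervalIntegrable (fun s : ℝ => (1 - s) ^ (-(1 / p))) volume 0 1 := by
    have hexp : -1 < -(1 / p) := by rwa [neg_lt_neg_iff, div_lt_one (by linarith)]
    simpa using
      (intervalIntegral.intervalIntegrable_rpow' (a := 1) (b := 0) hexp).comp_sub_left 1
  have hright : IntervalIntegrable (arcsinDeriv p) volume 0 1 := by
    refine hmajorant.mono_fun (measurable_arcsinDeriv p).aestronglyMeasurable ?_
    refine (ae_restrict_iff' measurableSet_uIoc).2 (.of_forall fun _ hs => ?_)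
    exact norm_arcsinDeriv_le hp (by rwa [uIoc_of_le zero_le_one] at hs)
  have hleft : IntervalIntegrable (arcsinDeriv p) volume 0 (-1) := by
    simpa [arcsinDeriv_neg] using hright.comp_sub_left 0
  refine (hleft.symm.trans hright).mono_set ?_
  rw [uIcc_of_le (by norm_num : (-1 : ℝ) ≤ 1)]
  exact uIcc_subset_Icc hx hy

lemma arcsinP_sub_arcsinP (hp : 1 < p) (hx : x ∈ Icc (-1 : ℝ) 1) (hy : y ∈ Icc (-1 : ℝ) 1) :
    arcsinP p y - arcsinP p x = ∫ s in x..y, arcsinDeriv p s :=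
  intervalIntegral.integral_interval_sub_left
    (intervalIntegrable_arcsinDeriv hp (by norm_num) hy)
    (intervalIntegrable_arcsinDeriv hp (by norm_num) hx)

lemma sub_le_arcsinP_sub (hp : 1 < p) (hx : x ∈ Icc (-1 : ℝ) 1) (hy : y ∈ Icc (-1 : ℝ) 1)
    (hxy : x ≤ y) : y - x ≤ arcsinP p y - arcsinP p x := by
  rw [arcsinP_sub_arcsinP hp hx hy]
  calc y - x = ∫ _ in x..y, (1 : ℝ) := by simp
    _ ≤ ∫ s in x..y, arcsinDeriv p s :=
      intervalIntegral.integral_mono_on_of_le_Ioo hxy (by simp)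
        (intervalIntegrable_arcsinDeriv hp hx hy) fun _ hs =>
          one_le_arcsinDeriv (by linarith) ⟨hx.1.trans_lt hs.1, hs.2.trans_le hy.2⟩

lemma strictMonoOn_arcsinP (hp : 1 < p) : StrictMonoOn (arcsinP p) (Icc (-1) 1) :=
  fun x hx y hy hxy => by linarith [sub_le_arcsinP_sub hp hx hy hxy.le]

lemma arcsinP_zero (p : ℝ) : arcsinP p 0 = 0 := intervalIntegral.integral_same

lemma arcsinP_neg (p y : ℝ) : arcsinP p (-y) = -arcsinP p y := by
  have hsubst := intervalIntegral.integral_comp_neg (a := 0) (b := y) (arcsinDeriv p)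
  simp only [arcsinDeriv_neg, neg_zero] at hsubst
  change ∫ s in (0 : ℝ)..-y, arcsinDeriv p s = -∫ s in (0 : ℝ)..y, arcsinDeriv p s
  rw [hsubst, intervalIntegral.integral_symm]

lemma arcsinP_one (hp : 1 < p) : arcsinP p 1 = piP p / 2 := by
  have htotal : arcsinP p 1 - arcsinP p (-1) = piP p :=
    arcsinP_sub_arcsinP hp (by norm_num) (by norm_num)
  rw [arcsinP_neg] at htotal
  linarith

lemma piP_pos (hp : 1 < p) : 0 < piP p := by
  have hlt := strictMonoOn_arcsinP hp (by norm_num) (by norm_num) (zero_lt_one (α := ℝ))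
  rw [arcsinP_zero, arcsinP_one hp] at hlt
  linarith

lemma continuousOn_arcsinP (hp : 1 < p) : ContinuousOn (arcsinP p) (Icc (-1) 1) := by
  have hcont := intervalIntegral.continuousOn_primitive_interval' (a := (0 : ℝ))
    (intervalIntegrable_arcsinDeriv hp (x := -1) (y := 1) (by norm_num) (by norm_num))
    (by rw [uIcc_of_le] <;> norm_num)
  rwa [uIcc_of_le (by norm_num)] at hcont

lemma hasDerivAt_arcsinP (hp : 1 < p) (hy : y ∈ Ioo (-1 : ℝ) 1) :
    HasDerivAt (arcsinP p) (arcsinDeriv p y) y := by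
  have hlt : |y| ^ p < 1 := abs_rpow_lt_one (by linarith) hy
  refine intervalIntegral.integral_hasDerivAt_right
    (intervalIntegrable_arcsinDeriv hp (by norm_num) (Ioo_subset_Icc_self hy))
    (measurable_arcsinDeriv p).stronglyMeasurable.stronglyMeasurableAtFilter ?_
  have hbase : ContinuousAt (fun s : ℝ => 1 - |s| ^ p) y :=
    continuousAt_const.sub (continuousAt_id.abs.rpow_const (Or.inr (by linarith)))
  exact continuousAt_const.div (hbase.rpow_const (Or.inl (by linarith)))
    (Real.rpow_pos_of_pos (by linarith) _).ne'

lemma surjOn_arcsinP (hp : 1 < p) : SurjOn (arcsinP p) (Icc (-1) 1) (principalBranch p) := by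
  have hivt := intermediate_value_Icc (by norm_num) (continuousOn_arcsinP hp)
  rwa [arcsinP_neg, arcsinP_one hp] at hivt

lemma reduceP_eq_self (hp : 1 < p) (ht : t ∈ principalBranch p) : reduceP p t = t := by
  have hpi := piP_pos hp
  have hfloor : ⌊(t + piP p / 2) / (2 * piP p)⌋ = 0 := by
    rw [Int.floor_eq_zero_iff]
    refine ⟨div_nonneg (by linarith [ht.1]) (by linarith), ?_⟩
    rw [div_lt_one (by linarith)]
    linarith [ht.2]
  simp [reduceP, hfloor]

lemma reduceP_mem (hp : 1 < p) (t : ℝ) : reduceP p t ∈ Icc (-(piP p / 2)) (3 * piP p / 2) := by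
  have hperiod : 0 < 2 * piP p := by linarith [piP_pos hp]
  have hle := Int.floor_le ((t + piP p / 2) / (2 * piP p))
  have hlt := Int.lt_floor_add_one ((t + piP p / 2) / (2 * piP p))
  rw [le_div_iff₀ hperiod] at hle
  rw [div_lt_iff₀ hperiod] at hlt
  unfold reduceP
  constructor <;> linarith

lemma sinP_mem (hp : 1 < p) (t : ℝ) : sinP p t ∈ Icc (-1 : ℝ) 1 := by
  have hmem := reduceP_mem hp t
  unfold sinP
  split_ifs with hle
  · exact Function.invFunOn_mem (surjOn_arcsinP hp ⟨hmem.1, hle⟩)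
  · exact Function.invFunOn_mem
      (surjOn_arcsinP hp ⟨by linarith [hmem.2], by linarith [not_le.1 hle]⟩)

lemma abs_sinP_le_one (hp : 1 < p) (t : ℝ) : |sinP p t| ≤ 1 := abs_le.2 (sinP_mem hp t)

lemma abs_sinP_rpow_le_one (hp : 1 < p) (t : ℝ) : |sinP p t| ^ p ≤ 1 :=
  Real.rpow_le_one (abs_nonneg _) (abs_sinP_le_one hp t) (by linarith)

lemma arcsinP_sinP (hp : 1 < p) (ht : t ∈ principalBranch p) : arcsinP p (sinP p t) = t := by
  rw [sinP, reduceP_eq_self hp ht, if_pos ht.2]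
  exact Function.invFunOn_eq (surjOn_arcsinP hp ht)

lemma sinP_eq_of_arcsinP_eq (hp : 1 < p) (hy : y ∈ Icc (-1 : ℝ) 1) (ht : t ∈ principalBranch p)
    (hyt : arcsinP p y = t) : sinP p t = y :=
  (strictMonoOn_arcsinP hp).injOn (sinP_mem hp t) hy ((arcsinP_sinP hp ht).trans hyt.symm)

lemma neg_mem_principalBranch (ht : t ∈ principalBranch p) : -t ∈ principalBranch p :=
  ⟨neg_le_neg ht.2, neg_le.1 ht.1⟩

lemma zero_mem_principalBranch (hp : 1 < p) : 0 ∈ principalBranch p := by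
  have hpi := piP_pos hp
  constructor <;> linarith

lemma half_piP_mem_principalBranch (hp : 1 < p) : piP p / 2 ∈ principalBranch p :=
  ⟨by linarith [piP_pos hp], le_rfl⟩

lemma sinP_neg (hp : 1 < p) (ht : t ∈ principalBranch p) : sinP p (-t) = -sinP p t := by
  have hmem := sinP_mem hp t
  refine sinP_eq_of_arcsinP_eq hp ⟨neg_le_neg hmem.2, neg_le.1 hmem.1⟩
    (neg_mem_principalBranch ht) ?_
  rw [arcsinP_neg, arcsinP_sinP hp ht]

lemma sinP_zero (hp : 1 < p) : sinP p 0 = 0 :=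
  sinP_eq_of_arcsinP_eq hp (by norm_num) (zero_mem_principalBranch hp) (arcsinP_zero p)

lemma sinP_half_piP (hp : 1 < p) : sinP p (piP p / 2) = 1 :=
  sinP_eq_of_arcsinP_eq hp (by norm_num) (half_piP_mem_principalBranch hp) (arcsinP_one hp)

lemma sinP_neg_half_piP (hp : 1 < p) : sinP p (-(piP p / 2)) = -1 := by
  rw [sinP_neg hp (half_piP_mem_principalBranch hp), sinP_half_piP hp]

lemma strictMonoOn_sinP (hp : 1 < p) : StrictMonoOn (sinP p) (principalBranch p) := by
  intro s hs t ht hst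
  by_contra! hle
  have hexp := sub_le_arcsinP_sub hp (sinP_mem hp t) (sinP_mem hp s) hle
  rw [arcsinP_sinP hp hs, arcsinP_sinP hp ht] at hexp
  linarith

lemma lipschitzOnWith_sinP (hp : 1 < p) : LipschitzOnWith 1 (sinP p) (principalBranch p) := by
  refine LipschitzOnWith.of_le_add fun s hs t ht => ?_
  rcases le_total s t with hst | hts
  · linarith [(strictMonoOn_sinP hp).monotoneOn hs ht hst, dist_nonneg (x := s) (y := t)]
  · have hexp := sub_le_arcsinP_sub hp (sinP_mem hp t) (sinP_mem hp s)
      ((strictMonoOn_sinP hp).monotoneOn ht hs hts)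
    rw [arcsinP_sinP hp hs, arcsinP_sinP hp ht] at hexp
    linarith [Real.dist_eq s t, le_abs_self (s - t)]

lemma sinP_mem_Ioo (hp : 1 < p) (ht : t ∈ Ioo (-(piP p / 2)) (piP p / 2)) :
    sinP p t ∈ Ioo (-1 : ℝ) 1 := by
  have hmono := strictMonoOn_sinP hp
  have hhalf := half_piP_mem_principalBranch hp
  have ht' := Ioo_subset_Icc_self ht
  exact ⟨sinP_neg_half_piP hp ▸ hmono (neg_mem_principalBranch hhalf) ht' ht.1,
    sinP_half_piP hp ▸ hmono ht' hhalf ht.2⟩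

lemma abs_sinP_rpow_lt_one (hp : 1 < p) (ht : t ∈ Ioo (-(piP p / 2)) (piP p / 2)) :
    |sinP p t| ^ p < 1 :=
  abs_rpow_lt_one (by linarith) (sinP_mem_Ioo hp ht)

lemma hasDerivAt_sinP_rpow_root (hp : 1 < p) (ht : t ∈ Ioo (-(piP p / 2)) (piP p / 2)) :
    HasDerivAt (sinP p) ((1 - |sinP p t| ^ p) ^ (1 / p)) t := by
  have hnhds : principalBranch p ∈ nhds t := Icc_mem_nhds ht.1 ht.2
  have hS := sinP_mem_Ioo hp ht
  have hderiv := HasDerivAt.of_local_left_inverse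
    ((lipschitzOnWith_sinP hp).continuousOn.continuousAt hnhds) (hasDerivAt_arcsinP hp hS)
    (by linarith [one_le_arcsinDeriv (p := p) (by linarith) hS])
    (Filter.mem_of_superset hnhds fun s hs => arcsinP_sinP hp hs)
  simpa only [arcsinDeriv, one_div, inv_inv] using hderiv

-- At the endpoints `sin_p` has a global extremum, so its derivative vanishes there as well.
lemma cosP_eq (hp : 1 < p) (ht : t ∈ principalBranch p) :
    cosP p t = (1 - |sinP p t| ^ p) ^ (1 / p) := by
  have hp0 : p ≠ 0 := by linarith
  rcases ht.1.eq_or_lt with rfl | hlt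
  · have hmin : IsLocalMin (sinP p) (-(piP p / 2)) :=
      .of_forall fun s => sinP_neg_half_piP hp ▸ (sinP_mem hp s).1
    simp [cosP, hmin.deriv_eq_zero, sinP_neg_half_piP hp, hp0]
  rcases ht.2.eq_or_lt with rfl | hgt
  · have hmax : IsLocalMax (sinP p) (piP p / 2) :=
      .of_forall fun s => sinP_half_piP hp ▸ (sinP_mem hp s).2
    simp [cosP, hmax.deriv_eq_zero, sinP_half_piP hp, hp0]
  exact (hasDerivAt_sinP_rpow_root hp ⟨hlt, hgt⟩).deriv

lemma hasDerivAt_sinP (hp : 1 < p) (ht : t ∈ Ioo (-(piP p / 2)) (piP p / 2)) :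
    HasDerivAt (sinP p) (cosP p t) t :=
  cosP_eq hp (Ioo_subset_Icc_self ht) ▸ hasDerivAt_sinP_rpow_root hp ht

lemma cosP_nonneg (hp : 1 < p) (ht : t ∈ principalBranch p) : 0 ≤ cosP p t := by
  rw [cosP_eq hp ht]
  exact Real.rpow_nonneg (sub_nonneg.2 (abs_sinP_rpow_le_one hp t)) _

lemma cosP_pos (hp : 1 < p) (ht : t ∈ Ioo (-(piP p / 2)) (piP p / 2)) : 0 < cosP p t := by
  rw [cosP_eq hp (Ioo_subset_Icc_self ht)]
  exact Real.rpow_pos_of_pos (sub_pos.2 (abs_sinP_rpow_lt_one hp ht)) _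

lemma cosP_rpow (hp : 1 < p) (ht : t ∈ principalBranch p) (q : ℝ) :
    cosP p t ^ q = (1 - |sinP p t| ^ p) ^ (q / p) := by
  rw [cosP_eq hp ht, ← Real.rpow_mul (sub_nonneg.2 (abs_sinP_rpow_le_one hp t)),
    one_div_mul_eq_div]

lemma cosP_le_one (hp : 1 < p) (ht : t ∈ principalBranch p) : cosP p t ≤ 1 := by
  have hpow : 0 ≤ |sinP p t| ^ p := by positivity
  rw [cosP_eq hp ht]
  exact Real.rpow_le_one (sub_nonneg.2 (abs_sinP_rpow_le_one hp t)) (by linarith) (by positivity)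

lemma cosP_neg (hp : 1 < p) (ht : t ∈ principalBranch p) : cosP p (-t) = cosP p t := by
  rw [cosP_eq hp ht, cosP_eq hp (neg_mem_principalBranch ht), sinP_neg hp ht, abs_neg]

lemma cosP_neg_half_piP (hp : 1 < p) : cosP p (-(piP p / 2)) = 0 := by
  have hp0 : p ≠ 0 := by linarith
  rw [cosP_eq hp (neg_mem_principalBranch (half_piP_mem_principalBranch hp)),
    sinP_neg_half_piP hp]
  simp [hp0]

lemma continuousOn_cosP (hp : 1 < p) : ContinuousOn (cosP p) (principalBranch p) := by
  have hbase : ContinuousOn (fun t => 1 - |sinP p t| ^ p) (principalBranch p) :=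
    continuousOn_const.sub ((lipschitzOnWith_sinP hp).continuousOn.abs.rpow_const
      fun _ _ => Or.inr (by linarith))
  exact (hbase.rpow_const fun _ _ => Or.inr (by positivity)).congr fun t ht => cosP_eq hp ht

lemma hasDerivAt_cosP_rpow (hp : 1 < p) (ht : t ∈ Ioo (-(piP p / 2)) (piP p / 2)) :
    HasDerivAt (fun t => cosP p t ^ (p - 1))
      (-(p - 1) * (|sinP p t| ^ (p - 2) * sinP p t)) t := by
  have hp0 : p ≠ 0 := by linarith
  have hbase : 0 < 1 - |sinP p t| ^ p := sub_pos.2 (abs_sinP_rpow_lt_one hp ht)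
  have hpow : HasDerivAt (fun s => 1 - |sinP p s| ^ p)
      (-(p * |sinP p t| ^ (p - 2) * sinP p t * cosP p t)) t :=
    ((hasDerivAt_abs_rpow (sinP p t) hp).comp t (hasDerivAt_sinP hp ht)).const_sub 1
  have hcancel : (1 - |sinP p t| ^ p) ^ ((p - 1) / p - 1) * cosP p t = 1 := by
    rw [cosP_eq hp (Ioo_subset_Icc_self ht), ← Real.rpow_add hbase,
      show (p - 1) / p - 1 + 1 / p = 0 by field_simp; ring, Real.rpow_zero]
  have heq : (fun s => cosP p s ^ (p - 1)) =ᶠ[nhds t]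
      fun s => (1 - |sinP p s| ^ p) ^ ((p - 1) / p) :=
    Filter.mem_of_superset (Icc_mem_nhds ht.1 ht.2) fun s hs => cosP_rpow hp hs (p - 1)
  refine ((hpow.rpow_const (Or.inl hbase.ne')).congr_of_eventuallyEq heq).congr_deriv ?_
  calc _ = -(p * ((p - 1) / p)) * (|sinP p t| ^ (p - 2) * sinP p t) *
        ((1 - |sinP p t| ^ p) ^ ((p - 1) / p - 1) * cosP p t) := by ring
    _ = _ := by rw [hcancel]; field_simp

lemma abs_rpow_sub_two_mul_abs (hp : 1 < p) (s : ℝ) : |s| ^ (p - 2) * |s| = |s| ^ (p - 1) := by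
  rcases eq_or_ne s 0 with rfl | hs
  · simp [Real.zero_rpow (by linarith : p - 1 ≠ 0)]
  · rw [← Real.rpow_add_one (abs_ne_zero.2 hs)]
    ring_nf

lemma abs_cosP_rpow_mul (hp : 1 < p) (ht : t ∈ principalBranch p) :
    |cosP p t| ^ (p - 2) * cosP p t = cosP p t ^ (p - 1) := by
  have habs := abs_rpow_sub_two_mul_abs hp (cosP p t)
  rwa [abs_of_nonneg (cosP_nonneg hp ht)] at habs ⊢

lemma lipschitzOnWith_cosP_rpow (hp : 1 < p) :
    LipschitzOnWith (Real.toNNReal (p - 1)) (fun t => cosP p t ^ (p - 1)) (principalBranch p) := by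
  have hp1 : 0 ≤ p - 1 := by linarith
  have hpi := piP_pos hp
  have hclosure : closure (Ioo (-(piP p / 2)) (piP p / 2)) = principalBranch p :=
    closure_Ioo (by linarith)
  have hcont := (continuousOn_cosP hp).rpow_const (p := p - 1) fun _ _ => Or.inr hp1
  rw [← hclosure] at hcont ⊢
  refine .closure hcont ((convex_Ioo _ _).lipschitzOnWith_of_nnnorm_hasDerivWithin_le
    (fun t ht => (hasDerivAt_cosP_rpow hp ht).hasDerivWithinAt) fun t _ => ?_)
  rw [← NNReal.coe_le_coe, coe_nnnorm, Real.coe_toNNReal _ hp1, Real.norm_eq_abs, abs_mul,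
    abs_neg, abs_of_nonneg hp1, abs_mul, Real.abs_rpow_of_nonneg (abs_nonneg _), abs_abs,
    abs_rpow_sub_two_mul_abs hp]
  exact mul_le_of_le_one_right hp1
    (Real.rpow_le_one (abs_nonneg _) (abs_sinP_le_one hp t) hp1)

end Trigonometry

/-! ### Shooting for a scalar ODE -/

section Shooting

variable {T G φ ψ : ℝ → ℝ} {M L : NNReal} {α β a b c x : ℝ} {s t : Set ℝ}

/-- `φ` solves `φ' = α + T G(φ)` on `s`, with one-sided derivatives at the endpoints of `s`. -/
def IsTrajectory (T G : ℝ → ℝ) (α : ℝ) (s : Set ℝ) (φ : ℝ → ℝ) : Prop :=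
  ∀ x ∈ s, HasDerivWithinAt φ (α + T x * G (φ x)) s x

lemma IsTrajectory.mono (hφ : IsTrajectory T G α t φ) (hst : s ⊆ t) : IsTrajectory T G α s φ :=
  fun x hx => (hφ x (hst hx)).mono hst

lemma IsTrajectory.continuousOn (hφ : IsTrajectory T G α s φ) : ContinuousOn φ s :=
  fun x hx => (hφ x hx).continuousWithinAt

lemma IsTrajectory.hasDerivAt (hφ : IsTrajectory T G α (Icc a b) φ) (hx : x ∈ Ioo a b) :
    HasDerivAt φ (α + T x * G (φ x)) x :=
  (hφ x (Ioo_subset_Icc_self hx)).hasDerivAt (Icc_mem_nhds hx.1 hx.2)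

lemma lipschitzWith_const_add_mul (hc : |c| ≤ M) (hG : LipschitzWith L G) (α : ℝ) :
    LipschitzWith (M * L) fun y => α + c * G y := by
  refine .of_dist_le_mul fun y z => ?_
  rw [dist_add_left, Real.dist_eq, ← mul_sub, abs_mul, NNReal.coe_mul, mul_assoc]
  exact mul_le_mul hc (hG.dist_le_mul y z) (abs_nonneg _) M.2

lemma exists_isTrajectory {x₀ y₀ B : ℝ} (hx₀ : x₀ ∈ Icc a b) (hT : ContinuousOn T (Icc a b))
    (hM : ∀ x ∈ Icc a b, |T x| ≤ M) (hG : LipschitzWith L G) (hB : ∀ y, |G y| ≤ B) (α : ℝ) :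
    ∃ φ, φ x₀ = y₀ ∧ IsTrajectory T G α (Icc a b) φ := by
  have hB0 : 0 ≤ B := (abs_nonneg _).trans (hB 0)
  have hbound : ∀ x ∈ Icc a b, ∀ y, ‖α + T x * G y‖ ≤ |α| + M * B := fun x hx y => by
    refine (abs_add_le _ _).trans (add_le_add_right ?_ _)
    rw [abs_mul]
    exact mul_le_mul (hM x hx) (hB y) (abs_nonneg _) M.2
  have hpicard : IsPicardLindelof (fun x y => α + T x * G y) (⟨x₀, hx₀⟩ : Icc a b) y₀
      (Real.toNNReal ((|α| + M * B) * (b - a))) 0 (Real.toNNReal (|α| + M * B)) (M * L) := by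
    have hba : 0 ≤ b - a := by linarith [hx₀.1, hx₀.2]
    refine ⟨fun x hx => (lipschitzWith_const_add_mul (hM x hx) hG α).lipschitzOnWith,
      fun y _ => continuousOn_const.add (hT.mul continuousOn_const), fun x hx y _ => ?_, ?_⟩
    · exact (hbound x hx y).trans (Real.le_coe_toNNReal _)
    · rw [Real.coe_toNNReal _ (by positivity), Real.coe_toNNReal _ (by positivity),
        NNReal.coe_zero, sub_zero]
      gcongr
      exact max_le (by linarith [hx₀.1]) (by linarith [hx₀.2])
  exact hpicard.exists_eq_forall_mem_Icc_hasDerivWithinAt₀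

lemma IsTrajectory.dist_le (hM : ∀ x ∈ Icc a b, |T x| ≤ M) (hG : LipschitzWith L G)
    (hφ : IsTrajectory T G α (Icc a b) φ) (hψ : IsTrajectory T G β (Icc a b) ψ)
    (ha : φ a = ψ a) (hx : x ∈ Icc a b) :
    dist (φ x) (ψ x) ≤ gronwallBound 0 (M * L) (dist β α) (x - a) := by
  have hright : ∀ {f : ℝ → ℝ} {f' x : ℝ}, x ∈ Ico a b → HasDerivWithinAt f f' (Icc a b) x →
      HasDerivWithinAt f f' (Ici x) x := fun hx hf =>
    hf.mono_of_mem_nhdsWithin (Icc_mem_nhdsGE_of_mem hx)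
  have hgronwall := dist_le_of_approx_trajectories_ODE_of_mem (v := fun x y => α + T x * G y)
    (s := fun _ => univ) (δ := 0) (εf := 0) (εg := dist β α)
    (fun x hx => (lipschitzWith_const_add_mul (hM x (Ico_subset_Icc_self hx)) hG α).lipschitzOnWith)
    hφ.continuousOn (fun x hx => hright hx (hφ x (Ico_subset_Icc_self hx)))
    (fun _ _ => (dist_self _).le) (fun _ _ => mem_univ _)
    hψ.continuousOn (fun x hx => hright hx (hψ x (Ico_subset_Icc_self hx)))
    (fun _ _ => (dist_add_right _ _ _).le) (fun _ _ => mem_univ _) (by rw [ha, dist_self]) x hx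
  simpa using hgronwall

lemma IsTrajectory.eqOn (hM : ∀ x ∈ Icc a b, |T x| ≤ M) (hG : LipschitzWith L G)
    (hφ : IsTrajectory T G α (Icc a b) φ) (hψ : IsTrajectory T G α (Icc a b) ψ)
    (ha : φ a = ψ a) : EqOn φ ψ (Icc a b) := fun x hx => by
  have hdist := hφ.dist_le hM hG hψ ha hx
  rwa [dist_self, gronwallBound_ε0_δ0, dist_le_zero] at hdist

lemma continuous_isTrajectory_right {Φ : ℝ → ℝ → ℝ} {y₀ : ℝ} (hab : a ≤ b)
    (hM : ∀ x ∈ Icc a b, |T x| ≤ M) (hG : LipschitzWith L G)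
    (hΦ : ∀ α, IsTrajectory T G α (Icc a b) (Φ α)) (ha : ∀ α, Φ α a = y₀) :
    Continuous fun α => Φ α b := by
  refine continuous_iff_continuousAt.2 fun α => tendsto_iff_dist_tendsto_zero.2 ?_
  refine squeeze_zero (fun _ => dist_nonneg) (fun β => (hΦ β).dist_le hM hG (hΦ α)
    ((ha β).trans (ha α).symm) (right_mem_Icc.2 hab)) ?_
  have hcont : Continuous fun β => gronwallBound 0 (M * L) (dist α β) (b - a) :=
    (gronwallBound_continuous_ε 0 (M * L) (b - a)).comp (by fun_prop)
  simpa only [dist_self, gronwallBound_ε0_δ0] using hcont.tendsto α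

lemma IsTrajectory.mul_sub_le (hφ : IsTrajectory T G α (Icc a b) φ) (hab : a ≤ b)
    (hT : ∀ x ∈ Icc a b, 0 ≤ T x) (hG : ∀ y, 0 ≤ G y) : α * (b - a) ≤ φ b - φ a := by
  refine (convex_Icc a b).mul_sub_le_image_sub_of_le_deriv hφ.continuousOn ?_ ?_ a
    (left_mem_Icc.2 hab) b (right_mem_Icc.2 hab) hab
  · rw [interior_Icc]
    exact fun x hx => (hφ.hasDerivAt hx).differentiableAt.differentiableWithinAt
  · rw [interior_Icc]
    intro x hx
    rw [(hφ.hasDerivAt hx).deriv]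
    linarith [mul_nonneg (hT x (Ioo_subset_Icc_self hx)) (hG (φ x))]

lemma IsTrajectory.strictMonoOn (hφ : IsTrajectory T G α (Icc a b) φ) (hα : 0 < α)
    (hT : ∀ x ∈ Icc a b, 0 ≤ T x) (hG : ∀ y, 0 ≤ G y) : StrictMonoOn φ (Icc a b) := by
  intro x hx y hy hxy
  have hsub : Icc x y ⊆ Icc a b := Icc_subset_Icc hx.1 hy.2
  have hgrowth := (hφ.mono hsub).mul_sub_le hxy.le (fun z hz => hT z (hsub hz)) hG
  linarith [mul_pos hα (sub_pos.2 hxy)]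

lemma IsTrajectory.reflect {D : ℝ} (hT : ∀ x ∈ Icc 0 D, T (D - x) = T x)
    (hG : ∀ y, G (-y) = G y) (hφ : IsTrajectory T G α (Icc 0 D) φ) :
    IsTrajectory T G α (Icc 0 D) fun x => -φ (D - x) := by
  intro x hx
  have hmaps : MapsTo (fun y => D - y) (Icc 0 D) (Icc 0 D) :=
    fun y hy => ⟨sub_nonneg.2 hy.2, sub_le_self _ hy.1⟩
  have hcomp := (hφ (D - x) (hmaps hx)).comp x
    ((hasDerivAt_id x).const_sub D).hasDerivWithinAt hmaps
  refine hcomp.neg.congr_deriv ?_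
  rw [hG, hT x hx]
  ring

-- The midpoint is the initial point: the endpoint value is continuous in `α`, it vanishes at
-- `α = 0` and is at least `b` at `α = 2b/D`, and oddness about `D/2` settles the other endpoint.
lemma exists_shooting {D B : ℝ} (hD : 0 < D) (hb : 0 < b)
    (hT : ContinuousOn T (Icc 0 D)) (hT0 : ∀ x ∈ Icc 0 D, 0 ≤ T x)
    (hTsymm : ∀ x ∈ Icc 0 D, T (D - x) = T x) (hG : LipschitzWith L G) (hG0 : ∀ y, 0 ≤ G y)
    (hGB : ∀ y, G y ≤ B) (hGeven : ∀ y, G (-y) = G y) (hGzero : G 0 = 0) :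
    ∃ α > 0, ∃ φ, φ 0 = -b ∧ φ (D / 2) = 0 ∧ φ D = b ∧ IsTrajectory T G α (Icc 0 D) φ := by
  obtain ⟨C, hC⟩ := isCompact_Icc.exists_bound_of_continuousOn hT
  have hM : ∀ x ∈ Icc 0 D, |T x| ≤ C.toNNReal := fun x hx => (hC x hx).trans (le_max_left _ _)
  choose Φ hΦmid hΦ using exists_isTrajectory (y₀ := 0)
    (⟨by linarith, by linarith⟩ : D / 2 ∈ Icc 0 D) hT hM hG
    fun y => (abs_of_nonneg (hG0 y)).trans_le (hGB y)
  have hle : D / 2 ≤ D := by linarith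
  have hsub : Icc (D / 2) D ⊆ Icc 0 D := Icc_subset_Icc_left (by linarith)
  have hM' : ∀ x ∈ Icc (D / 2) D, |T x| ≤ C.toNNReal := fun x hx => hM x (hsub hx)
  have hΦ' : ∀ α, IsTrajectory T G α (Icc (D / 2) D) (Φ α) := fun α => (hΦ α).mono hsub
  have hzero : Φ 0 D = 0 := by
    have htriv : IsTrajectory T G 0 (Icc (D / 2) D) fun _ => 0 := fun x _ => by
      simpa [hGzero] using hasDerivWithinAt_const x (Icc (D / 2) D) (0 : ℝ)
    exact (hΦ' 0).eqOn hM' hG htriv (hΦmid 0) (right_mem_Icc.2 hle)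
  have hlarge : b ≤ Φ (2 * b / D) D := by
    have hgrowth := (hΦ' (2 * b / D)).mul_sub_le hle (fun x hx => hT0 x (hsub hx)) hG0
    have harea : 2 * b / D * (D - D / 2) = b := by field_simp; ring
    linarith [hΦmid (2 * b / D)]
  obtain ⟨α, hα, hαb⟩ : ∃ α ∈ Icc 0 (2 * b / D), Φ α D = b :=
    intermediate_value_Icc (by positivity)
      (continuous_isTrajectory_right hle hM' hG hΦ' hΦmid).continuousOn
      ⟨hzero.trans_le hb.le, hlarge⟩
  have hα0 : α ≠ 0 := by
    rintro rfl
    exact hb.ne (hzero.symm.trans hαb)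
  have hodd : Φ α D = -Φ α (D - D) := (hΦ' α).eqOn hM' hG
    (((hΦ α).reflect hTsymm hGeven).mono hsub) (by simp [sub_half, hΦmid]) (right_mem_Icc.2 hle)
  rw [sub_self] at hodd
  exact ⟨α, hα.1.lt_of_ne' hα0, Φ α, by linarith, hΦmid α, hαb, hΦ α⟩

end Shooting

/-! ### The model coefficients -/

section ModelCoefficients

variable {K N κ x : ℝ}

lemma curvature_nonpos (hK : K ≤ 0) (hN : 1 < N) : K / (N - 1) ≤ 0 :=
  div_nonpos_of_nonpos_of_nonneg hK (by linarith)

lemma continuous_sK (κ : ℝ) : Continuous (sK κ) := by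
  unfold sK
  split_ifs <;> fun_prop

lemma sK_pos (hκ : κ ≤ 0) (hx : 0 < x) : 0 < sK κ x := by
  unfold sK
  split_ifs with h0
  · exact hx
  · have hr : 0 < √(-κ) := Real.sqrt_pos.2 (neg_pos.2 (hκ.lt_of_ne h0))
    exact div_pos (Real.sinh_pos_iff.2 (by positivity)) hr

lemma hasDerivAt_sK (hκ : κ ≤ 0) (x : ℝ) : HasDerivAt (sK κ) (Real.cosh (√(-κ) * x)) x := by
  unfold sK
  split_ifs with h0
  · simpa [h0] using hasDerivAt_id' x
  · have hr : √(-κ) ≠ 0 := (Real.sqrt_pos.2 (neg_pos.2 (hκ.lt_of_ne h0))).ne'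
    refine ((((hasDerivAt_id' x).const_mul √(-κ)).sinh).div_const √(-κ)).congr_deriv ?_
    field_simp

lemma monotone_sK (hκ : κ ≤ 0) : Monotone (sK κ) :=
  monotone_of_hasDerivAt_nonneg (hasDerivAt_sK hκ) fun _ => (Real.cosh_pos _).le

lemma cotKN_eq (hN : 1 < N) (x : ℝ) :
    cotKN K N x = (N - 1) * (Real.cosh (√(-(K / (N - 1))) * x) / sK (K / (N - 1)) x) := by
  have hN1 : 0 < N - 1 := by linarith
  rcases eq_or_ne K 0 with rfl | h0
  · simp [cotKN, sK, div_eq_mul_inv]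
  · have hsqrt : √(-K * (N - 1)) = (N - 1) * √(-K / (N - 1)) := by
      rw [show -K * (N - 1) = (N - 1) ^ 2 * (-K / (N - 1)) by field_simp,
        Real.sqrt_mul (by positivity), Real.sqrt_sq hN1.le]
    rw [cotKN, sK, if_neg h0, if_neg (div_ne_zero h0 hN1.ne'), hsqrt, ← neg_div, mul_assoc,
      div_div_eq_mul_div]
    ring

lemma hasDerivAt_sK_rpow (hK : K ≤ 0) (hN : 1 < N) (hx : 0 < x) :
    HasDerivAt (fun x => sK (K / (N - 1)) x ^ (N - 1))
      (cotKN K N x * sK (K / (N - 1)) x ^ (N - 1)) x := by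
  have hκ := curvature_nonpos hK hN
  have hpos := sK_pos hκ hx
  refine ((hasDerivAt_sK hκ x).rpow_const (Or.inl hpos.ne')).congr_deriv ?_
  rw [cotKN_eq hN, Real.rpow_sub_one hpos.ne']
  ring

lemma continuousOn_cotKN (hK : K ≤ 0) (hN : 1 < N) : ContinuousOn (cotKN K N) (Ioi 0) := by
  rw [funext (cotKN_eq hN)]
  exact continuousOn_const.mul ((by fun_prop : Continuous _).continuousOn.div
    (continuous_sK _).continuousOn fun x hx => (sK_pos (curvature_nonpos hK hN) hx).ne')

lemma cotKN_nonneg (hK : K ≤ 0) (hN : 1 < N) (hx : 0 < x) : 0 ≤ cotKN K N x := by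
  have hs := sK_pos (curvature_nonpos hK hN) hx
  rw [cotKN_eq hN]
  exact mul_nonneg (by linarith) (div_nonneg (Real.cosh_pos _).le hs.le)

end ModelCoefficients

/-! ### The Prüfer angle of the model -/

section PruferAngle

variable {p K N D b x y : ℝ}

/-- The nearest-point projection of the line onto `[-b, b]`. -/
def clamp (b y : ℝ) : ℝ := max (-b) (min y b)

lemma clamp_mem (hb : 0 ≤ b) (y : ℝ) : clamp b y ∈ Icc (-b) b :=
  ⟨le_max_left _ _, max_le (by linarith) (min_le_right _ _)⟩

lemma clamp_of_mem (hy : y ∈ Icc (-b) b) : clamp b y = y := by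
  rw [clamp, min_eq_left hy.2, max_eq_right hy.1]

lemma clamp_neg (hb : 0 ≤ b) (y : ℝ) : clamp b (-y) = -clamp b y := by
  unfold clamp
  grind

lemma lipschitzWith_clamp (b : ℝ) : LipschitzWith 1 (clamp b) :=
  (LipschitzWith.id.min_const b).const_max (-b)

lemma lipschitzOnWith_mul_of_abs_le_one {f g : ℝ → ℝ} {A B : NNReal} {s : Set ℝ}
    (hf : LipschitzOnWith A f s) (hg : LipschitzOnWith B g s)
    (hf1 : ∀ x ∈ s, |f x| ≤ 1) (hg1 : ∀ x ∈ s, |g x| ≤ 1) :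
    LipschitzOnWith (A + B) (fun x => f x * g x) s := by
  refine .of_dist_le_mul fun x hx y hy => ?_
  have hfxy := hf.dist_le_mul x hx y hy
  have hgxy := hg.dist_le_mul x hx y hy
  rw [Real.dist_eq] at hfxy hgxy ⊢
  calc |f x * g x - f y * g y| = |(f x - f y) * g x + f y * (g x - g y)| := by ring_nf
    _ ≤ |f x - f y| * |g x| + |f y| * |g x - g y| := by
      rw [← abs_mul, ← abs_mul]
      exact abs_add_le _ _
    _ ≤ |f x - f y| + |g x - g y| :=
      add_le_add (mul_le_of_le_one_right (abs_nonneg _) (hg1 x hx))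
        (mul_le_of_le_one_left (abs_nonneg _) (hf1 y hy))
    _ ≤ ↑(A + B) * dist x y := by
      push_cast
      linarith

/-- The nonlinearity `cos_p^{p-1} |sin_p|` of the Prüfer equation, evaluated at the angle clamped to
`[-π_p/2, π_p/2]` so as to be globally Lipschitz. The absolute value makes it even; it is undone
by the sign change of the coefficient `modelT` at `D/2`, where the Prüfer angle vanishes. -/
noncomputable def pruferField (p y : ℝ) : ℝ :=
  cosP p (clamp (piP p / 2) y) ^ (p - 1) * |sinP p (clamp (piP p / 2) y)|

lemma clamp_half_piP_mem (hp : 1 < p) (y : ℝ) : clamp (piP p / 2) y ∈ principalBranch p :=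
  clamp_mem (half_pos (piP_pos hp)).le y

lemma pruferField_of_mem (hy : y ∈ principalBranch p) :
    pruferField p y = cosP p y ^ (p - 1) * |sinP p y| := by
  rw [pruferField, clamp_of_mem hy]

lemma pruferField_zero (hp : 1 < p) : pruferField p 0 = 0 := by
  rw [pruferField_of_mem (zero_mem_principalBranch hp), sinP_zero hp, abs_zero, mul_zero]

lemma pruferField_neg (hp : 1 < p) (y : ℝ) : pruferField p (-y) = pruferField p y := by
  have hmem := clamp_half_piP_mem hp y
  rw [pruferField, pruferField, clamp_neg (half_pos (piP_pos hp)).le, cosP_neg hp hmem,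
    sinP_neg hp hmem, abs_neg]

lemma pruferField_nonneg (hp : 1 < p) (y : ℝ) : 0 ≤ pruferField p y :=
  mul_nonneg (Real.rpow_nonneg (cosP_nonneg hp (clamp_half_piP_mem hp y)) _) (abs_nonneg _)

lemma cosP_rpow_le_one (hp : 1 < p) (hy : y ∈ principalBranch p) : cosP p y ^ (p - 1) ≤ 1 :=
  Real.rpow_le_one (cosP_nonneg hp hy) (cosP_le_one hp hy) (by linarith)

lemma pruferField_le_one (hp : 1 < p) (y : ℝ) : pruferField p y ≤ 1 :=
  mul_le_one₀ (cosP_rpow_le_one hp (clamp_half_piP_mem hp y)) (abs_nonneg _)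
    (abs_sinP_le_one hp _)

lemma lipschitzWith_pruferField (hp : 1 < p) :
    LipschitzWith (((p - 1).toNNReal + 1) * 1) (pruferField p) := by
  have habs : LipschitzOnWith 1 (fun y => |sinP p y|) (principalBranch p) :=
    .of_dist_le_mul fun y hy z hz =>
      (abs_abs_sub_abs_le _ _).trans ((lipschitzOnWith_sinP hp).dist_le_mul y hy z hz)
  have hcos1 : ∀ y ∈ principalBranch p, |cosP p y ^ (p - 1)| ≤ 1 := fun y hy => by
    rw [abs_of_nonneg (Real.rpow_nonneg (cosP_nonneg hp hy) _)]
    exact cosP_rpow_le_one hp hy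
  have hfield := lipschitzOnWith_mul_of_abs_le_one (lipschitzOnWith_cosP_rpow hp) habs hcos1
    fun y _ => (abs_abs _).trans_le (abs_sinP_le_one hp y)
  exact lipschitzOnWith_univ.1 (hfield.comp (lipschitzWith_clamp _).lipschitzOnWith
    fun y _ => clamp_half_piP_mem hp y)

lemma cotKN_mul_abs_eq {s : ℝ} (hright : D / 2 ≤ x → 0 ≤ s) (hleft : x ≤ D / 2 → s ≤ 0) :
    cotKN K N (D / 2 + |x - D / 2|) * |s| = modelT K N D x * s := by
  unfold modelT
  split_ifs with hx
  · rw [abs_of_nonneg (hright hx), abs_of_nonneg (sub_nonneg.2 hx), add_sub_cancel]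
  · have hx' := (not_le.1 hx).le
    rw [abs_of_nonpos (hleft hx'), abs_of_nonpos (sub_nonpos.2 hx'),
      show D / 2 + -(x - D / 2) = D - x by ring]
    ring

lemma isPruferSolution_of_isTrajectory {α : ℝ} {φ : ℝ → ℝ} (hp : 1 < p) (hD : 0 < D) (hα : 0 < α)
    (hφ : IsTrajectory (fun x => 1 / (p - 1) * cotKN K N (D / 2 + |x - D / 2|)) (pruferField p) α
      (Icc 0 D) φ)
    (hmono : StrictMonoOn φ (Icc 0 D)) (h0 : φ 0 = -(piP p / 2)) (hmid : φ (D / 2) = 0)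
    (hD' : φ D = piP p / 2) : IsPruferSolution p K N D ((p - 1) * α ^ p) φ := by
  refine ⟨fun x hx => (hφ x hx).congr_deriv ?_, h0, hmid, hD'⟩
  have hp1 : 0 < p - 1 := by linarith
  have hrange : φ x ∈ principalBranch p := by
    simpa only [h0, hD'] using hmono.monotoneOn.mapsTo_Icc hx
  have hmidmem : D / 2 ∈ Icc 0 D := ⟨by linarith, by linarith⟩
  have hsin := (strictMonoOn_sinP hp).monotoneOn
  have hzero := zero_mem_principalBranch hp
  have hright : D / 2 ≤ x → 0 ≤ sinP p (φ x) := fun h => sinP_zero hp ▸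
    hsin hzero hrange (hmid ▸ hmono.monotoneOn hmidmem hx h)
  have hleft : x ≤ D / 2 → sinP p (φ x) ≤ 0 := fun h => sinP_zero hp ▸
    hsin hrange hzero (hmid ▸ hmono.monotoneOn hx hmidmem h)
  have hroot : ((p - 1) * α ^ p / (p - 1)) ^ (1 / p) = α := by
    rw [mul_div_cancel_left₀ _ hp1.ne', one_div, Real.rpow_rpow_inv hα.le (by linarith)]
  rw [hroot, abs_cosP_rpow_mul hp hrange, pruferField_of_mem hrange]
  linear_combination 1 / (p - 1) * cosP p (φ x) ^ (p - 1) *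
    cotKN_mul_abs_eq (K := K) (N := N) hright hleft

lemma exists_pruferSolution (hp : 1 < p) (hK : K ≤ 0) (hN : 1 < N) (hD : 0 < D) :
    ∃ α > 0, ∃ φ : ℝ → ℝ, IsPruferSolution p K N D ((p - 1) * α ^ p) φ ∧
      StrictMonoOn φ (Icc 0 D) := by
  have harg : ∀ x, 0 < D / 2 + |x - D / 2| := fun x => by positivity
  have hT : Continuous fun x => 1 / (p - 1) * cotKN K N (D / 2 + |x - D / 2|) :=
    continuous_const.mul ((continuousOn_cotKN hK hN).comp_continuous (by fun_prop) harg)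
  have hT0 : ∀ x, 0 ≤ 1 / (p - 1) * cotKN K N (D / 2 + |x - D / 2|) :=
    fun x => mul_nonneg (one_div_nonneg.2 (sub_nonneg.2 hp.le)) (cotKN_nonneg hK hN (harg x))
  obtain ⟨α, hα, φ, h0, hmid, hD', hφ⟩ := exists_shooting hD (half_pos (piP_pos hp))
    hT.continuousOn (fun x _ => hT0 x)
    (fun x _ => by rw [show D - x - D / 2 = -(x - D / 2) by ring, abs_neg])
    (lipschitzWith_pruferField hp) (pruferField_nonneg hp) (pruferField_le_one hp)
    (pruferField_neg hp) (pruferField_zero hp)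
  have hmono := hφ.strictMonoOn hα (fun x _ => hT0 x) (pruferField_nonneg hp)
  exact ⟨α, hα, φ, isPruferSolution_of_isTrajectory hp hD hα hφ hmono h0 hmid hD', hmono⟩

end PruferAngle

/-! ### The mixed eigenfunction of the model on the left half -/

lemma hasDerivAt_integral_of_mem_Ioo {g : ℝ → ℝ} {a b x : ℝ} (hg : ContinuousOn g (Icc a b))
    (hx : x ∈ Ioo a b) : HasDerivAt (fun y => ∫ t in a..y, g t) (g x) x := by
  have hnhds : Icc a b ∈ nhds x := Icc_mem_nhds hx.1 hx.2
  refine intervalIntegral.integral_hasDerivAt_right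
    ((hg.mono (Icc_subset_Icc_right hx.2.le)).intervalIntegrable_of_Icc hx.1.le) ?_
    (hg.continuousAt hnhds)
  rw [← nhdsWithin_eq_nhds.2 hnhds]
  exact hg.stronglyMeasurableAtFilter_nhdsWithin measurableSet_Icc x

lemma continuousOn_integral {g : ℝ → ℝ} {a b : ℝ} (hab : a ≤ b) (hg : ContinuousOn g (Icc a b)) :
    ContinuousOn (fun y => ∫ t in a..y, g t) (Icc a b) := by
  rw [← uIcc_of_le hab] at hg ⊢
  exact intervalIntegral.continuousOn_primitive_interval hg.integrableOn_uIcc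

section LeftModel

variable {K N D x : ℝ}

/-- The left half `s_κ(D - x)^{N-1}` of the model density, continued to `(-∞, D)`. -/
noncomputable def leftModel (K N D x : ℝ) : ℝ := sK (K / (N - 1)) (D - x) ^ (N - 1)

lemma leftModel_pos (hK : K ≤ 0) (hN : 1 < N) (hx : x < D) : 0 < leftModel K N D x :=
  Real.rpow_pos_of_pos (sK_pos (curvature_nonpos hK hN) (sub_pos.2 hx)) _

lemma continuous_leftModel (hN : 1 < N) : Continuous (leftModel K N D) :=
  ((continuous_sK _).comp (continuous_const.sub continuous_id)).rpow_const
    fun _ => Or.inr (by linarith)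

lemma hasDerivAt_leftModel (hK : K ≤ 0) (hN : 1 < N) (hx : x < D) :
    HasDerivAt (leftModel K N D) (-cotKN K N (D - x) * leftModel K N D x) x := by
  refine ((hasDerivAt_sK_rpow hK hN (sub_pos.2 hx)).comp x
    ((hasDerivAt_id x).const_sub D)).congr_deriv ?_
  rw [leftModel]
  ring

end LeftModel

/-- The averaged flux `(1 / k(s)) ∫_0^s k f^{p-1}`. -/
noncomputable def meanFlux (p : ℝ) (k f : ℝ → ℝ) (s : ℝ) : ℝ :=
  (∫ t in (0 : ℝ)..s, k t * f t ^ (p - 1)) / k s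

/-- The slope `-v'` of a decreasing solution `v` of `(k |v'|^{p-2} v')' = -lam k f^{p-1}` with
`v'(0) = 0`. -/
noncomputable def fluxSlope (p lam : ℝ) (k f : ℝ → ℝ) (s : ℝ) : ℝ :=
  (lam * meanFlux p k f s) ^ (1 / (p - 1))

/-- `f` is a positive eigenfunction, for the eigenvalue `lam`, of the weighted `p`-Laplacian with
the model weight on `[0, D/2]`, with a Neumann condition at `0` and a Dirichlet condition at `D/2`.
The equation `(m |f'|^{p-2} f')' = -lam m f^{p-1}` is stated in integrated form. -/
structure IsModelEigenfunction (p K N D lam : ℝ) (f : ℝ → ℝ) : Prop where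
  continuousOn : ContinuousOn f (Icc 0 (D / 2))
  pos : ∀ x ∈ Ico 0 (D / 2), 0 < f x
  eq_integral : ∀ x ∈ Icc 0 (D / 2), f x =
    ∫ s in x..(D / 2), fluxSlope p lam (leftModel K N D) f s

/-- The restriction to `[0, D/2]` of an increasing solution of the Prüfer equation. -/
structure IsLeftPruferAngle (p K N D α : ℝ) (φ : ℝ → ℝ) : Prop where
  continuousOn : ContinuousOn φ (Icc 0 (D / 2))
  strictMonoOn : StrictMonoOn φ (Icc 0 (D / 2))
  left : φ 0 = -(piP p / 2)
  right : φ (D / 2) = 0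
  hasDerivAt : ∀ x ∈ Ioo 0 (D / 2), HasDerivAt φ
    (α - 1 / (p - 1) * cotKN K N (D - x) * (cosP p (φ x) ^ (p - 1) * sinP p (φ x))) x

section ModelEigenfunction

variable {p K N D α x : ℝ} {φ : ℝ → ℝ}

lemma IsPruferSolution.isLeftPruferAngle (hp : 1 < p) (hD : 0 < D) (hα : 0 < α)
    (hφ : IsPruferSolution p K N D ((p - 1) * α ^ p) φ) (hmono : StrictMonoOn φ (Icc 0 D)) :
    IsLeftPruferAngle p K N D α φ := by
  have hsub : Icc 0 (D / 2) ⊆ Icc 0 D := Icc_subset_Icc_right (by linarith)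
  refine ⟨fun x hx => ((hφ.ode x (hsub hx)).mono hsub).continuousWithinAt, hmono.mono hsub,
    hφ.left, hφ.mid, fun x hx => ?_⟩
  have hxD : x ∈ Icc 0 D := hsub (Ioo_subset_Icc_self hx)
  have hmem : φ x ∈ principalBranch p := by
    simpa only [hφ.left, hφ.right] using hmono.monotoneOn.mapsTo_Icc hxD
  have hroot : ((p - 1) * α ^ p / (p - 1)) ^ (1 / p) = α := by
    rw [mul_div_cancel_left₀ _ (by linarith : p - 1 ≠ 0), one_div,
      Real.rpow_rpow_inv hα.le (by linarith)]
  have hode := (hφ.ode x hxD).hasDerivAt (Icc_mem_nhds hx.1 (by linarith [hx.2]))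
  rw [hroot, abs_cosP_rpow_mul hp hmem, modelT, if_neg (not_le.2 hx.2)] at hode
  exact hode.congr_deriv (by ring)

namespace IsLeftPruferAngle

lemma mem_Icc (hφ : IsLeftPruferAngle p K N D α φ) (hx : x ∈ Icc 0 (D / 2)) :
    φ x ∈ Icc (-(piP p / 2)) 0 := by
  simpa only [hφ.left, hφ.right] using hφ.strictMonoOn.monotoneOn.mapsTo_Icc hx

lemma mem_principalBranch (hφ : IsLeftPruferAngle p K N D α φ) (hp : 1 < p)
    (hx : x ∈ Icc 0 (D / 2)) : φ x ∈ principalBranch p :=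
  Icc_subset_Icc_right (half_pos (piP_pos hp)).le (hφ.mem_Icc hx)

lemma mem_Ioo (hφ : IsLeftPruferAngle p K N D α φ) (hp : 1 < p) (hx : x ∈ Ioo 0 (D / 2)) :
    φ x ∈ Ioo (-(piP p / 2)) (piP p / 2) := by
  refine ⟨hφ.left ▸ hφ.strictMonoOn ?_ (Ioo_subset_Icc_self hx) hx.1,
    (hφ.mem_Icc (Ioo_subset_Icc_self hx)).2.trans_lt (half_pos (piP_pos hp))⟩
  exact left_mem_Icc.2 (hx.1.trans hx.2).le

lemma sinP_neg (hφ : IsLeftPruferAngle p K N D α φ) (hp : 1 < p) (hx : x ∈ Ico 0 (D / 2)) :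
    sinP p (φ x) < 0 := by
  have hx' := Ico_subset_Icc_self hx
  rw [← sinP_zero hp]
  refine strictMonoOn_sinP hp (hφ.mem_principalBranch hp hx') (zero_mem_principalBranch hp) ?_
  exact hφ.right ▸ hφ.strictMonoOn hx' (right_mem_Icc.2 (hx.1.trans hx.2.le)) hx.2

lemma continuousOn_cosP (hφ : IsLeftPruferAngle p K N D α φ) (hp : 1 < p) :
    ContinuousOn (fun x => cosP p (φ x)) (Icc 0 (D / 2)) :=
  (MCPGap.continuousOn_cosP hp).comp hφ.continuousOn fun _ => hφ.mem_principalBranch hp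

lemma continuousOn_sinP (hφ : IsLeftPruferAngle p K N D α φ) (hp : 1 < p) :
    ContinuousOn (fun x => sinP p (φ x)) (Icc 0 (D / 2)) :=
  (lipschitzOnWith_sinP hp).continuousOn.comp hφ.continuousOn fun _ => hφ.mem_principalBranch hp

lemma continuousOn_cotKN_mul_cosP (hφ : IsLeftPruferAngle p K N D α φ) (hp : 1 < p) (hK : K ≤ 0)
    (hN : 1 < N) (hD : 0 < D) :
    ContinuousOn (fun x => cotKN K N (D - x) * cosP p (φ x) ^ p) (Icc 0 (D / 2)) := by
  refine .mul ((continuousOn_cotKN hK hN).comp (by fun_prop) fun x hx => mem_Ioi.2 ?_)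
    ((hφ.continuousOn_cosP hp).rpow_const fun _ _ => Or.inr (by linarith))
  linarith [hx.2]

end IsLeftPruferAngle

/-- The amplitude `r` belonging to a Prüfer angle `φ` on the left half: the eigenfunction is
`-r sin_p φ` and its derivative is `-α r cos_p φ`. -/
noncomputable def pruferAmplitude (p K N D : ℝ) (φ : ℝ → ℝ) (x : ℝ) : ℝ :=
  Real.exp ((∫ t in (0 : ℝ)..x, cotKN K N (D - t) * cosP p (φ t) ^ p) / (p - 1))

lemma pruferAmplitude_pos : 0 < pruferAmplitude p K N D φ x := Real.exp_pos _

namespace IsLeftPruferAngle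

lemma hasDerivAt_pruferAmplitude (hφ : IsLeftPruferAngle p K N D α φ) (hp : 1 < p) (hK : K ≤ 0)
    (hN : 1 < N) (hx : x ∈ Ioo 0 (D / 2)) :
    HasDerivAt (pruferAmplitude p K N D φ)
      (pruferAmplitude p K N D φ x * (cotKN K N (D - x) * cosP p (φ x) ^ p / (p - 1))) x :=
  ((hasDerivAt_integral_of_mem_Ioo (hφ.continuousOn_cotKN_mul_cosP hp hK hN
    (by linarith [hx.1, hx.2])) hx).div_const _).exp

lemma continuousOn_pruferAmplitude (hφ : IsLeftPruferAngle p K N D α φ) (hp : 1 < p) (hK : K ≤ 0)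
    (hN : 1 < N) (hD : 0 < D) : ContinuousOn (pruferAmplitude p K N D φ) (Icc 0 (D / 2)) :=
  ((continuousOn_integral (half_pos hD).le
    (hφ.continuousOn_cotKN_mul_cosP hp hK hN hD)).div_const _).rexp

lemma hasDerivAt_mul_sinP (hφ : IsLeftPruferAngle p K N D α φ) (hp : 1 < p) (hK : K ≤ 0)
    (hN : 1 < N) (hx : x ∈ Ioo 0 (D / 2)) :
    HasDerivAt (fun y => pruferAmplitude p K N D φ y * sinP p (φ y))
      (α * pruferAmplitude p K N D φ x * cosP p (φ x)) x := by
  have hsin := (hasDerivAt_sinP hp (hφ.mem_Ioo hp hx)).comp x (hφ.hasDerivAt x hx)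
  refine ((hφ.hasDerivAt_pruferAmplitude hp hK hN hx).mul hsin).congr_deriv ?_
  have hcos := (cosP_pos hp (hφ.mem_Ioo hp hx)).ne'
  rw [Real.rpow_sub_one hcos]
  simp only [Function.comp]
  field_simp
  ring

lemma integral_mul_cosP (hφ : IsLeftPruferAngle p K N D α φ) (hp : 1 < p) (hK : K ≤ 0)
    (hN : 1 < N) (hD : 0 < D) (hx : x ∈ Icc 0 (D / 2)) :
    ∫ s in x..(D / 2), α * pruferAmplitude p K N D φ s * cosP p (φ s) =
      -(pruferAmplitude p K N D φ x * sinP p (φ x)) := by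
  have hsub : Icc x (D / 2) ⊆ Icc 0 (D / 2) := Icc_subset_Icc_left hx.1
  have hr := hφ.continuousOn_pruferAmplitude hp hK hN hD
  rw [intervalIntegral.integral_eq_sub_of_hasDerivAt_of_le hx.2
    ((hr.mul (hφ.continuousOn_sinP hp)).mono hsub)
    (fun y hy => hφ.hasDerivAt_mul_sinP hp hK hN ⟨hx.1.trans_lt hy.1, hy.2⟩)
    ((((continuousOn_const.mul hr).mul (hφ.continuousOn_cosP hp)).mono
      hsub).intervalIntegrable_of_Icc hx.2)]
  simp only [Pi.mul_apply, hφ.right, sinP_zero hp]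
  ring

lemma hasDerivAt_flux (hφ : IsLeftPruferAngle p K N D α φ) (hp : 1 < p) (hK : K ≤ 0)
    (hN : 1 < N) (hx : x ∈ Ioo 0 (D / 2)) :
    HasDerivAt (fun y => pruferAmplitude p K N D φ y ^ (p - 1) * cosP p (φ y) ^ (p - 1) *
      leftModel K N D y)
      ((p - 1) * α * (leftModel K N D x *
        (-(pruferAmplitude p K N D φ x * sinP p (φ x))) ^ (p - 1))) x := by
  have hp1 : 0 < p - 1 := by linarith
  have hr := pruferAmplitude_pos (p := p) (K := K) (N := N) (D := D) (φ := φ) (x := x)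
  have hS := hφ.sinP_neg hp ⟨hx.1.le, hx.2⟩
  have hS0 := abs_pos.2 hS.ne
  have hcos := (hasDerivAt_cosP_rpow hp (hφ.mem_Ioo hp hx)).comp x (hφ.hasDerivAt x hx)
  have hmodel := hasDerivAt_leftModel (D := D) hK hN (by linarith [hx.1, hx.2] : x < D)
  refine ((((hφ.hasDerivAt_pruferAmplitude hp hK hN hx).rpow_const
    (p := p - 1) (Or.inl hr.ne')).mul hcos).mul hmodel).congr_deriv ?_
  have hfp : (-(pruferAmplitude p K N D φ x * sinP p (φ x))) ^ (p - 1) =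
      pruferAmplitude p K N D φ x ^ (p - 1) * -(|sinP p (φ x)| ^ (p - 2) * sinP p (φ x)) := by
    rw [← mul_neg, ← abs_of_neg hS, Real.mul_rpow hr.le hS0.le, ← abs_rpow_sub_two_mul_abs hp]
    nth_rewrite 2 [abs_of_neg hS]
    ring
  have hcosp : cosP p (φ x) ^ p = 1 - |sinP p (φ x)| ^ (p - 2) * sinP p (φ x) ^ 2 := by
    rw [cosP_rpow hp (Ioo_subset_Icc_self (hφ.mem_Ioo hp hx)), ← sq_abs (sinP p (φ x)),
      ← Real.rpow_natCast, ← Real.rpow_add hS0, div_self (by linarith), Real.rpow_one]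
    norm_num
  rw [hfp, hcosp, Real.rpow_sub_one hr.ne' (p - 1)]
  simp only [Function.comp, Pi.mul_apply]
  field_simp
  ring

lemma integral_leftModel_mul (hφ : IsLeftPruferAngle p K N D α φ) (hp : 1 < p) (hK : K ≤ 0)
    (hN : 1 < N) (hD : 0 < D) (hx : x ∈ Icc 0 (D / 2)) :
    (p - 1) * α * ∫ t in (0 : ℝ)..x, leftModel K N D t *
      (-(pruferAmplitude p K N D φ t * sinP p (φ t))) ^ (p - 1) =
    pruferAmplitude p K N D φ x ^ (p - 1) * cosP p (φ x) ^ (p - 1) * leftModel K N D x := by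
  have hp1 : 0 < p - 1 := by linarith
  have hsub : Icc 0 x ⊆ Icc 0 (D / 2) := Icc_subset_Icc_right hx.2
  have hr := hφ.continuousOn_pruferAmplitude hp hK hN hD
  have hm : ContinuousOn (leftModel K N D) (Icc 0 (D / 2)) := (continuous_leftModel hN).continuousOn
  have hpow {g : ℝ → ℝ} (hg : ContinuousOn g (Icc 0 (D / 2))) :
      ContinuousOn (fun y => g y ^ (p - 1)) (Icc 0 (D / 2)) :=
    hg.rpow_const fun _ _ => Or.inr hp1.le
  have hflux := ((hpow hr).mul (hpow (hφ.continuousOn_cosP hp))).mul hm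
  have hsource := (hm.mul (hpow (hr.mul (hφ.continuousOn_sinP hp)).neg)).const_mul ((p - 1) * α)
  rw [← intervalIntegral.integral_const_mul,
    intervalIntegral.integral_eq_sub_of_hasDerivAt_of_le hx.1 (hflux.mono hsub)
      (fun y hy => hφ.hasDerivAt_flux hp hK hN ⟨hy.1, hy.2.trans_le hx.2⟩)
      ((hsource.mono hsub).intervalIntegrable_of_Icc hx.1)]
  simp only [Pi.mul_apply, hφ.left, cosP_neg_half_piP hp, Real.zero_rpow hp1.ne', mul_zero,
    zero_mul, sub_zero]

lemma isModelEigenfunction (hφ : IsLeftPruferAngle p K N D α φ) (hp : 1 < p) (hK : K ≤ 0)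
    (hN : 1 < N) (hD : 0 < D) (hα : 0 < α) :
    IsModelEigenfunction p K N D ((p - 1) * α ^ p)
      fun x => -(pruferAmplitude p K N D φ x * sinP p (φ x)) := by
  have hp1 : 0 < p - 1 := by linarith
  refine ⟨((hφ.continuousOn_pruferAmplitude hp hK hN hD).mul (hφ.continuousOn_sinP hp)).neg,
    fun x hx => neg_pos.2 (mul_neg_of_pos_of_neg pruferAmplitude_pos (hφ.sinP_neg hp hx)),
    fun x hx => ?_⟩
  rw [← hφ.integral_mul_cosP hp hK hN hD hx]
  refine intervalIntegral.integral_congr fun s hs => ?_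
  rw [uIcc_of_le hx.2] at hs
  have hs' : s ∈ Icc 0 (D / 2) := ⟨hx.1.trans hs.1, hs.2⟩
  have hr := pruferAmplitude_pos (p := p) (K := K) (N := N) (D := D) (φ := φ) (x := s)
  have hcos := cosP_nonneg hp (hφ.mem_principalBranch hp hs')
  have hm := (leftModel_pos hK hN (by linarith [hs'.2] : s < D)).ne'
  have hflux : (p - 1) * α ^ p * meanFlux p (leftModel K N D)
      (fun x => -(pruferAmplitude p K N D φ x * sinP p (φ x))) s =
      (α * pruferAmplitude p K N D φ s * cosP p (φ s)) ^ (p - 1) := by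
    rw [meanFlux, Real.mul_rpow (by positivity) hcos, Real.mul_rpow hα.le hr.le, mul_div_assoc',
      div_eq_iff hm]
    have hαp : α ^ p = α ^ (p - 1) * α := by
      rw [Real.rpow_sub_one hα.ne', div_mul_cancel₀ _ hα.ne']
    linear_combination α ^ (p - 1) * hφ.integral_leftModel_mul hp hK hN hD hs' +
      (p - 1) * (∫ t in (0 : ℝ)..s, leftModel K N D t *
        (-(pruferAmplitude p K N D φ t * sinP p (φ t))) ^ (p - 1)) * hαp
  rw [fluxSlope, hflux, one_div, Real.rpow_rpow_inv (by positivity) hp1.ne']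

end IsLeftPruferAngle

lemma exists_isModelEigenfunction (hp : 1 < p) (hK : K ≤ 0) (hN : 1 < N) (hD : 0 < D) :
    ∃ lam > 0, (∃ φ, IsPruferSolution p K N D lam φ) ∧
      ∃ f, IsModelEigenfunction p K N D lam f := by
  obtain ⟨α, hα, φ, hφ, hmono⟩ := exists_pruferSolution hp hK hN hD
  exact ⟨_, mul_pos (by linarith) (by positivity), ⟨φ, hφ⟩, _,
    (hφ.isLeftPruferAngle hp hD hα hmono).isModelEigenfunction hp hK hN hD hα⟩

end ModelEigenfunction

/-! ### A weighted Hardy inequality -/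

section Hardy

variable {p a b μ lam : ℝ} {u k f : ℝ → ℝ} {C : NNReal}

lemma lintegral_rpow_le_of_weight {Ω : Type*} [MeasurableSpace Ω] {ν : Measure Ω}
    {g θ : Ω → ENNReal} (hp : 1 < p) (hg : AEMeasurable g ν) (hθ : AEMeasurable θ ν)
    (hθ0 : ∀ᵐ s ∂ν, θ s ≠ 0) (hθtop : ∀ᵐ s ∂ν, θ s ≠ ⊤) :
    (∫⁻ s, g s ∂ν) ^ p ≤
      (∫⁻ s, g s ^ p * (θ s ^ (p - 1))⁻¹ ∂ν) * (∫⁻ s, θ s ∂ν) ^ (p - 1) := by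
  have hp0 : 0 < p := by linarith
  have hp1 : 0 < p - 1 := by linarith
  have hsplit : ∫⁻ s, g s ∂ν = ∫⁻ s, g s * θ s ^ (-((p - 1) / p)) * θ s ^ ((p - 1) / p) ∂ν := by
    refine lintegral_congr_ae ?_
    filter_upwards [hθ0, hθtop] with s h0 htop
    rw [mul_assoc, ← ENNReal.rpow_add _ _ h0 htop, neg_add_cancel, ENNReal.rpow_zero, mul_one]
  have hleft : ∀ s, (g s * θ s ^ (-((p - 1) / p))) ^ p = g s ^ p * (θ s ^ (p - 1))⁻¹ := fun s => by
    rw [ENNReal.mul_rpow_of_nonneg _ _ hp0.le, ← ENNReal.rpow_mul, neg_mul,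
      div_mul_cancel₀ _ hp0.ne', ENNReal.rpow_neg]
  have hright : ∀ s, (θ s ^ ((p - 1) / p)) ^ (p / (p - 1)) = θ s := fun s => by
    rw [← ENNReal.rpow_mul, div_mul_div_cancel₀ hp0.ne', div_self hp1.ne', ENNReal.rpow_one]
  have hholder := ENNReal.lintegral_mul_le_Lp_mul_Lq ν (Real.HolderConjugate.conjExponent hp)
    (hg.mul (hθ.pow_const (-((p - 1) / p)))) (hθ.pow_const ((p - 1) / p))
  simp only [Pi.mul_apply, Real.conjExponent, ← hsplit, hleft, hright] at hholder
  refine (ENNReal.rpow_le_rpow hholder hp0.le).trans_eq ?_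
  rw [ENNReal.mul_rpow_of_nonneg _ _ hp0.le, ← ENNReal.rpow_mul, ← ENNReal.rpow_mul,
    one_div_mul_cancel hp0.ne', ENNReal.rpow_one, one_div_div, div_mul_cancel₀ _ hp0.ne']

lemma lintegral_mul_lintegral_Ioi {ν : Measure ℝ} [SFinite ν] {g W : ℝ → ENNReal}
    (hg : AEMeasurable g ν) (hW : AEMeasurable W ν) :
    ∫⁻ x, g x * ∫⁻ s in Ioi x, W s ∂ν ∂ν = ∫⁻ s, W s * ∫⁻ x in Iio s, g x ∂ν ∂ν := by
  let T : Set (ℝ × ℝ) := {q | q.1 < q.2}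
  have hmeas : AEMeasurable (fun q => T.indicator (fun q => g q.1 * W q.2) q) (ν.prod ν) :=
    (hg.comp_fst.mul hW.comp_snd).indicator (measurableSet_lt measurable_fst measurable_snd)
  calc ∫⁻ x, g x * ∫⁻ s in Ioi x, W s ∂ν ∂ν
      = ∫⁻ x, ∫⁻ s, T.indicator (fun q => g q.1 * W q.2) (x, s) ∂ν ∂ν := by
        refine lintegral_congr fun x => ?_
        rw [← lintegral_indicator measurableSet_Ioi,
          ← lintegral_const_mul'' _ (hW.indicator measurableSet_Ioi)]
        exact lintegral_congr fun s => by simp [T, indicator_apply]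
    _ = ∫⁻ s, ∫⁻ x, T.indicator (fun q => g q.1 * W q.2) (x, s) ∂ν ∂ν :=
        lintegral_lintegral_swap hmeas
    _ = ∫⁻ s, W s * ∫⁻ x in Iio s, g x ∂ν ∂ν := by
        refine lintegral_congr fun s => ?_
        rw [← lintegral_indicator measurableSet_Iio,
          ← lintegral_const_mul'' _ (hg.indicator measurableSet_Iio)]
        exact lintegral_congr fun x => by simp [T, indicator_apply, mul_comm]

/- Schur's test for the Hardy operator `g ↦ ∫_x^∞ g`: Hölder's inequality with the weight `θ`
followed by Tonelli's theorem. -/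
lemma lintegral_hardy_le {ν : Measure ℝ} [SFinite ν] {g θ G v w : ℝ → ENNReal} (hp : 1 < p)
    (hg : AEMeasurable g ν) (hθ : AEMeasurable θ ν) (hG : AEMeasurable G ν)
    (hθ0 : ∀ᵐ s ∂ν, θ s ≠ 0) (hθtop : ∀ᵐ s ∂ν, θ s ≠ ⊤)
    (hw : ∀ᵐ x ∂ν, w x * (∫⁻ s in Ioi x, θ s ∂ν) ^ (p - 1) ≤ G x)
    (hv : ∀ᵐ s ∂ν, ∫⁻ x in Iio s, G x ∂ν ≤ θ s ^ (p - 1) * v s) :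
    ∫⁻ x, w x * (∫⁻ s in Ioi x, g s ∂ν) ^ p ∂ν ≤ ∫⁻ s, g s ^ p * v s ∂ν := by
  have hp1 : 0 < p - 1 := by linarith
  calc ∫⁻ x, w x * (∫⁻ s in Ioi x, g s ∂ν) ^ p ∂ν
      ≤ ∫⁻ x, G x * ∫⁻ s in Ioi x, g s ^ p * (θ s ^ (p - 1))⁻¹ ∂ν ∂ν := by
        refine lintegral_mono_ae (hw.mono fun x hx => ?_)
        have hholder := lintegral_rpow_le_of_weight hp (hg.restrict (s := Ioi x)) hθ.restrict
          (ae_restrict_of_ae hθ0) (ae_restrict_of_ae hθtop)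
        refine (mul_le_mul_right hholder _).trans ?_
        rw [mul_left_comm, mul_comm]
        exact mul_le_mul_left hx _
    _ = ∫⁻ s, g s ^ p * (θ s ^ (p - 1))⁻¹ * ∫⁻ x in Iio s, G x ∂ν ∂ν :=
        lintegral_mul_lintegral_Ioi hG ((hg.pow_const _).mul (hθ.pow_const _).inv)
    _ ≤ ∫⁻ s, g s ^ p * v s ∂ν := by
        refine lintegral_mono_ae ?_
        filter_upwards [hv, hθ0, hθtop] with s hs h0 htop
        rw [mul_assoc]
        refine mul_le_mul_right ((mul_le_mul_right hs _).trans_eq ?_) _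
        rw [← mul_assoc, ENNReal.inv_mul_cancel (mt (ENNReal.rpow_eq_zero_iff_of_pos hp1).1 h0)
          (ENNReal.rpow_ne_top_of_nonneg hp1.le htop), one_mul]

/-- The Poincaré inequality with constant `μ` on `[0, a]`, weight `k`, for Lipschitz functions
vanishing at `a`. -/
def HalfPoincare (p a μ : ℝ) (k : ℝ → ℝ) : Prop :=
  ∀ u : ℝ → ℝ, (∃ C, LipschitzWith C u) → u a = 0 →
    μ * ∫ x in (0 : ℝ)..a, |u x| ^ p * k x ≤ ∫ x in (0 : ℝ)..a, |deriv u x| ^ p * k x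

lemma ofReal_abs_sub_le_lintegral_deriv (hab : a ≤ b) (hu : LipschitzWith C u) :
    ENNReal.ofReal |u b - u a| ≤ ∫⁻ s in Ioo a b, ENNReal.ofReal |deriv u s| := by
  rw [← hu.lipschitzOnWith.absolutelyContinuousOnInterval.integral_deriv_eq_sub,
    intervalIntegral.integral_of_le hab, integral_Ioc_eq_integral_Ioo, ← Real.norm_eq_abs,
    ofReal_norm]
  refine (enorm_integral_le_lintegral_enorm _).trans_eq (lintegral_congr fun s => ?_)
  rw [← Real.norm_eq_abs, ofReal_norm]

lemma intervalIntegrable_abs_deriv_rpow_mul (hp : 0 ≤ p) (hu : LipschitzWith C u)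
    (hk : IntervalIntegrable k volume a b) :
    IntervalIntegrable (fun x => |deriv u x| ^ p * k x) volume a b := by
  have hbound : ∀ x, ‖|deriv u x| ^ p‖ ≤ (C : ℝ) ^ p := fun x => by
    rw [Real.norm_of_nonneg (by positivity)]
    exact Real.rpow_le_rpow (abs_nonneg _) (norm_deriv_le_of_lipschitz hu) hp
  have hmeas : Measurable fun x => |deriv u x| ^ p := (measurable_deriv u).norm.pow_const p
  exact ⟨hk.1.bdd_mul hmeas.aestronglyMeasurable (.of_forall hbound),
    hk.2.bdd_mul hmeas.aestronglyMeasurable (.of_forall hbound)⟩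

lemma intervalIntegrable_abs_rpow_mul (hp : 0 ≤ p) (hu : Continuous u)
    (hk : IntervalIntegrable k volume a b) :
    IntervalIntegrable (fun x => |u x| ^ p * k x) volume a b :=
  hk.continuousOn_mul (hu.abs.rpow_const fun _ => Or.inr hp).continuousOn

lemma intervalIntegrable_mul_rpow (hp : 1 < p) (hab : a ≤ b) (hk : IntervalIntegrable k volume a b)
    (hf : ContinuousOn f (Icc a b)) :
    IntervalIntegrable (fun t => k t * f t ^ (p - 1)) volume a b :=
  hk.mul_continuousOn (uIcc_of_le hab ▸ hf.rpow_const fun _ _ => Or.inr (by linarith))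

lemma ofReal_intervalIntegral (hab : a ≤ b) (hf : IntervalIntegrable f volume a b)
    (hf0 : ∀ x ∈ Ioo a b, 0 ≤ f x) :
    ENNReal.ofReal (∫ x in a..b, f x) = ∫⁻ x in Ioo a b, ENNReal.ofReal (f x) := by
  rw [intervalIntegral.integral_of_le hab, integral_Ioc_eq_integral_Ioo]
  exact ofReal_integral_eq_lintegral_ofReal
    ((intervalIntegrable_iff_integrableOn_Ioo_of_le hab).1 hf)
    (ae_restrict_of_forall_mem measurableSet_Ioo hf0)

lemma intervalIntegral_nonneg_of_Ioo (hab : a ≤ b) (hf : ∀ x ∈ Ioo a b, 0 ≤ f x) :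
    0 ≤ ∫ x in a..b, f x := by
  rw [intervalIntegral.integral_of_le hab, integral_Ioc_eq_integral_Ioo]
  exact setIntegral_nonneg measurableSet_Ioo hf

lemma meanFlux_pos {s : ℝ} (hkpos : ∀ x ∈ Ioo 0 a, 0 < k x) (hfpos : ∀ x ∈ Ioo 0 a, 0 < f x)
    (hkf : IntervalIntegrable (fun t => k t * f t ^ (p - 1)) volume 0 a) (hs : s ∈ Ioo 0 a) :
    0 < meanFlux p k f s := by
  have hsub : Ioo 0 s ⊆ Ioo 0 a := Ioo_subset_Ioo_right hs.2.le
  refine div_pos (intervalIntegral.intervalIntegral_pos_of_pos_on (hkf.mono_set ?_)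
    (fun x hx => mul_pos (hkpos x (hsub hx)) (Real.rpow_pos_of_pos (hfpos x (hsub hx)) _)) hs.1)
    (hkpos s hs)
  exact uIcc_subset_uIcc_left (mem_uIcc_of_le hs.1.le hs.2.le)

lemma fluxSlope_rpow {s : ℝ} (hp : 1 < p) (hs : 0 ≤ lam * meanFlux p k f s) :
    fluxSlope p lam k f s ^ (p - 1) = lam * meanFlux p k f s := by
  rw [fluxSlope, one_div, Real.rpow_inv_rpow hs (sub_pos.2 hp).ne']

lemma lintegral_source {s : ℝ} (hp : 1 < p) (hlam : 0 < lam) (hkpos : ∀ x ∈ Ioo 0 a, 0 < k x)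
    (hfpos : ∀ x ∈ Ioo 0 a, 0 < f x)
    (hkf : IntervalIntegrable (fun t => k t * f t ^ (p - 1)) volume 0 a) (hs : s ∈ Ioo 0 a) :
    ∫⁻ x in Ioo 0 s, ENNReal.ofReal (lam * (k x * f x ^ (p - 1))) =
      ENNReal.ofReal (fluxSlope p lam k f s) ^ (p - 1) * ENNReal.ofReal (k s) := by
  have hp1 : 0 < p - 1 := by linarith
  have hflux : 0 < lam * meanFlux p k f s := mul_pos hlam (meanFlux_pos hkpos hfpos hkf hs)
  have hslope : 0 ≤ fluxSlope p lam k f s := Real.rpow_nonneg hflux.le _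
  have hkfs := (hkf.mono_set
    (uIcc_subset_uIcc_left (mem_uIcc_of_le hs.1.le hs.2.le))).const_mul lam
  have hnonneg : ∀ x ∈ Ioo 0 s, 0 ≤ lam * (k x * f x ^ (p - 1)) := fun x hx =>
    have hxa : x ∈ Ioo 0 a := ⟨hx.1, hx.2.trans hs.2⟩
    mul_nonneg hlam.le (mul_pos (hkpos x hxa) (Real.rpow_pos_of_pos (hfpos x hxa) _)).le
  rw [← ofReal_intervalIntegral hs.1.le hkfs hnonneg, intervalIntegral.integral_const_mul,
    ENNReal.ofReal_rpow_of_nonneg hslope hp1.le, fluxSlope_rpow hp hflux.le,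
    ← ENNReal.ofReal_mul hflux.le, meanFlux, mul_assoc, div_mul_cancel₀ _ (hkpos s hs).ne']

lemma lintegral_le_of_supersolution (hp : 1 < p) (hμ : 0 ≤ μ) (hlam : 0 < lam)
    (hkpos : ∀ x ∈ Ioo 0 a, 0 < k x) (hfpos : ∀ x ∈ Ioo 0 a, 0 < f x)
    (hkf : IntervalIntegrable (fun t => k t * f t ^ (p - 1)) volume 0 a)
    (hρ : IntervalIntegrable (fluxSlope p lam k f) volume 0 a)
    (hsup : ∀ x ∈ Ioo 0 a,
      μ * (∫ s in x..a, fluxSlope p lam k f s) ^ (p - 1) ≤ lam * f x ^ (p - 1))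
    (hu : LipschitzWith C u) (hua : u a = 0) :
    ∫⁻ x in Ioo 0 a, ENNReal.ofReal (μ * k x) * ENNReal.ofReal |u x| ^ p ≤
      ∫⁻ x in Ioo 0 a, ENNReal.ofReal |deriv u x| ^ p * ENNReal.ofReal (k x) := by
  have hp1 : 0 < p - 1 := by linarith
  have hflux {s : ℝ} (hs : s ∈ Ioo 0 a) : 0 < lam * meanFlux p k f s :=
    mul_pos hlam (meanFlux_pos hkpos hfpos hkf hs)
  have hslope {s : ℝ} (hs : s ∈ Ioo 0 a) : 0 < fluxSlope p lam k f s :=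
    Real.rpow_pos_of_pos (hflux hs) _
  have hIoi {x : ℝ} (hx : x ∈ Ioo 0 a) : Ioi x ∩ Ioo 0 a = Ioo x a := by grind
  have hIio {s : ℝ} (hs : s ∈ Ioo 0 a) : Iio s ∩ Ioo 0 a = Ioo 0 s := by grind
  have hsub {c d : ℝ} (hc : c ∈ Icc 0 a) (hd : d ∈ Icc 0 a) : uIcc c d ⊆ uIcc 0 a :=
    uIcc_subset_uIcc (mem_uIcc_of_le hc.1 hc.2) (mem_uIcc_of_le hd.1 hd.2)
  have hmeas {g : ℝ → ℝ} (hg : IntervalIntegrable g volume 0 a) :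
      AEMeasurable (fun s => ENNReal.ofReal (g s)) (volume.restrict (Ioo 0 a)) :=
    (hg.1.mono_set Ioo_subset_Ioc_self).aestronglyMeasurable.aemeasurable.ennreal_ofReal
  refine le_trans (lintegral_mono_ae ?_) (lintegral_hardy_le hp
    (measurable_deriv u).norm.ennreal_ofReal.aemeasurable (hmeas hρ) (hmeas (hkf.const_mul lam))
    (w := fun x => ENNReal.ofReal (μ * k x)) (v := fun x => ENNReal.ofReal (k x)) ?_ ?_ ?_ ?_)
  all_goals refine ae_restrict_of_forall_mem measurableSet_Ioo fun x hx => ?_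
  · rw [Measure.restrict_restrict measurableSet_Ioi, hIoi hx]
    have hdiff := ofReal_abs_sub_le_lintegral_deriv hx.2.le hu
    rw [hua, zero_sub, abs_neg] at hdiff
    exact mul_le_mul_right (ENNReal.rpow_le_rpow hdiff (by linarith)) _
  · exact (ENNReal.ofReal_pos.2 (hslope hx)).ne'
  · exact ENNReal.ofReal_ne_top
  · rw [Measure.restrict_restrict measurableSet_Ioi, hIoi hx]
    have hk := (hkpos x hx).le
    have hρx := ofReal_intervalIntegral hx.2.le (hρ.mono_set
      (hsub (Ioo_subset_Icc_self hx) (right_mem_Icc.2 (hx.1.trans hx.2).le)))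
      fun s hs => (hslope ⟨hx.1.trans hs.1, hs.2⟩).le
    have hρ0 : 0 ≤ ∫ s in x..a, fluxSlope p lam k f s :=
      intervalIntegral_nonneg_of_Ioo hx.2.le
        fun s hs => (hslope ⟨hx.1.trans hs.1, hs.2⟩).le
    rw [← hρx, ENNReal.ofReal_rpow_of_nonneg hρ0 hp1.le, ← ENNReal.ofReal_mul (by positivity),
      mul_comm μ, mul_assoc, mul_left_comm lam]
    exact ENNReal.ofReal_le_ofReal (mul_le_mul_of_nonneg_left (hsup x hx) hk)
  · rw [Measure.restrict_restrict measurableSet_Iio, hIio hx]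
    exact (lintegral_source hp hlam hkpos hfpos hkf hx).le

lemma halfPoincare_of_supersolution (hp : 1 < p) (ha : 0 < a) (hμ : 0 ≤ μ) (hlam : 0 < lam)
    (hkpos : ∀ x ∈ Ioo 0 a, 0 < k x) (hk : IntervalIntegrable k volume 0 a)
    (hf : ContinuousOn f (Icc 0 a)) (hfpos : ∀ x ∈ Ioo 0 a, 0 < f x)
    (hρ : IntervalIntegrable (fluxSlope p lam k f) volume 0 a)
    (hsup : ∀ x ∈ Ioo 0 a,
      μ * (∫ s in x..a, fluxSlope p lam k f s) ^ (p - 1) ≤ lam * f x ^ (p - 1)) :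
    HalfPoincare p a μ k := by
  rintro u ⟨C, hu⟩ hua
  have hp0 : 0 ≤ p := by linarith
  have hkf := intervalIntegrable_mul_rpow hp ha.le hk hf
  have hk0 : ∀ x ∈ Ioo 0 a, 0 ≤ k x := fun x hx => (hkpos x hx).le
  have hgrad0 : ∀ x ∈ Ioo 0 a, 0 ≤ |deriv u x| ^ p * k x :=
    fun x hx => mul_nonneg (by positivity) (hk0 x hx)
  have hhardy := lintegral_le_of_supersolution hp hμ hlam hkpos hfpos hkf hρ hsup hu hua
  rw [← intervalIntegral.integral_const_mul,
    ← ENNReal.ofReal_le_ofReal_iff (intervalIntegral_nonneg_of_Ioo ha.le hgrad0),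
    ofReal_intervalIntegral ha.le ((intervalIntegrable_abs_rpow_mul hp0 hu.continuous hk).const_mul
      μ) fun x hx => mul_nonneg hμ (mul_nonneg (by positivity) (hk0 x hx)),
    ofReal_intervalIntegral ha.le (intervalIntegrable_abs_deriv_rpow_mul hp0 hu hk) hgrad0]
  have hofReal (c : ℝ) : ENNReal.ofReal (|c| ^ p) = ENNReal.ofReal |c| ^ p :=
    (ENNReal.ofReal_rpow_of_nonneg (abs_nonneg c) hp0).symm
  convert hhardy using 3 with x x
  · rw [mul_left_comm, ENNReal.ofReal_mul (by positivity), hofReal, mul_comm]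
  · rw [ENNReal.ofReal_mul (by positivity), hofReal]

end Hardy

/-! ### Comparison with the model on half intervals -/

/-- The weights on `(0, D)` produced by `MCP(K, N)` densities: positive, continuous, integrable, and
with logarithmic derivative between those of `s_κ(D - x)^{N-1}` and `s_κ(x)^{N-1}`. The last
condition is stated through the monotonicity of the two quotients. -/
structure IsMCPWeight (K N D : ℝ) (k : ℝ → ℝ) : Prop where
  pos : ∀ x ∈ Ioo 0 D, 0 < k x
  continuousOn : ContinuousOn k (Ioo 0 D)
  intervalIntegrable : IntervalIntegrable k volume 0 D
  mono : ∀ x y, 0 < x → x ≤ y → y < D → k x * leftModel K N D y ≤ k y * leftModel K N D x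
  anti : ∀ x y, 0 < x → x ≤ y → y < D →
    k y * sK (K / (N - 1)) x ^ (N - 1) ≤ k x * sK (K / (N - 1)) y ^ (N - 1)

lemma isMCPWeight_leftModel {K N D : ℝ} (hK : K ≤ 0) (hN : 1 < N) :
    IsMCPWeight K N D (leftModel K N D) where
  pos x hx := leftModel_pos hK hN hx.2
  continuousOn := (continuous_leftModel hN).continuousOn
  intervalIntegrable := (continuous_leftModel hN).intervalIntegrable 0 D
  mono x y _ _ _ := (mul_comm _ _).le
  anti x y hx hxy hy := by
    have hκ := curvature_nonpos hK hN
    have hN1 : 0 ≤ N - 1 := by linarith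
    have hDy : 0 ≤ sK (K / (N - 1)) (D - y) := (sK_pos hκ (sub_pos.2 hy)).le
    have hsx : 0 ≤ sK (K / (N - 1)) x := (sK_pos hκ hx).le
    exact mul_le_mul (Real.rpow_le_rpow hDy (monotone_sK hκ (by linarith)) hN1)
      (Real.rpow_le_rpow hsx (monotone_sK hκ hxy) hN1) (Real.rpow_nonneg hsx _)
      (leftModel_pos hK hN (hxy.trans_lt hy)).le

section Comparison

variable {p K N D lam a b c d x y s τ τ' η : ℝ} {k m f : ℝ → ℝ}

lemma IsModelEigenfunction.nonneg (hf : IsModelEigenfunction p K N D lam f)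
    (hx : x ∈ Icc 0 (D / 2)) : 0 ≤ f x := by
  rcases hx.2.eq_or_lt with rfl | h
  · rw [hf.eq_integral _ hx, intervalIntegral.integral_same]
  · exact (hf.pos x ⟨hx.1, h⟩).le

namespace IsMCPWeight

lemma pos_of_le_half (hk : IsMCPWeight K N D k) (hx : x ∈ Ioc 0 (D / 2)) : 0 < k x :=
  hk.pos x ⟨hx.1, by linarith [hx.1, hx.2]⟩

lemma intervalIntegrable_of_le (hk : IsMCPWeight K N D k) (ha : 0 ≤ a) (hab : a ≤ b) (hb : b ≤ D) :
    IntervalIntegrable k volume a b := by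
  refine hk.intervalIntegrable.mono_set ?_
  rw [uIcc_of_le hab, uIcc_of_le (ha.trans (hab.trans hb))]
  exact Icc_subset_Icc ha hb

lemma intervalIntegrable_source (hk : IsMCPWeight K N D k) (hp : 1 < p)
    (hf : IsModelEigenfunction p K N D lam f) (ha : 0 ≤ a) (hab : a ≤ b) (hb : b ≤ D / 2) :
    IntervalIntegrable (fun t => k t * f t ^ (p - 1)) volume a b :=
  intervalIntegrable_mul_rpow hp hab (hk.intervalIntegrable_of_le ha hab (by linarith))
    (hf.continuousOn.mono (Icc_subset_Icc ha hb))

lemma source_nonneg (hk : IsMCPWeight K N D k) (hf : IsModelEigenfunction p K N D lam f)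
    (hx : x ∈ Ioc 0 (D / 2)) : 0 ≤ k x * f x ^ (p - 1) :=
  mul_nonneg (hk.pos_of_le_half hx).le (Real.rpow_nonneg (hf.nonneg (Ioc_subset_Icc_self hx)) _)

lemma integral_source_mono (hk : IsMCPWeight K N D k) (hp : 1 < p)
    (hf : IsModelEigenfunction p K N D lam f) (ha : 0 ≤ a) (hab : a ≤ b) (hb : b ≤ D / 2) :
    ∫ t in (0 : ℝ)..a, k t * f t ^ (p - 1) ≤ ∫ t in (0 : ℝ)..b, k t * f t ^ (p - 1) :=
  intervalIntegral.integral_mono_interval le_rfl ha hab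
    (ae_restrict_of_forall_mem measurableSet_Ioc
      fun _ ht => hk.source_nonneg hf (Ioc_subset_Ioc_right hb ht))
    (hk.intervalIntegrable_source hp hf le_rfl (ha.trans hab) hb)

lemma meanFlux_nonneg (hk : IsMCPWeight K N D k) (hf : IsModelEigenfunction p K N D lam f)
    (hs : s ∈ Ioc 0 (D / 2)) : 0 ≤ meanFlux p k f s :=
  div_nonneg (intervalIntegral_nonneg_of_Ioo hs.1.le fun _ ht =>
    hk.source_nonneg hf ⟨ht.1, ht.2.le.trans hs.2⟩) (hk.pos_of_le_half hs).le

lemma fluxSlope_nonneg (hk : IsMCPWeight K N D k) (hlam : 0 ≤ lam)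
    (hf : IsModelEigenfunction p K N D lam f) (hs : s ∈ Ioc 0 (D / 2)) :
    0 ≤ fluxSlope p lam k f s :=
  Real.rpow_nonneg (mul_nonneg hlam (hk.meanFlux_nonneg hf hs)) _

lemma integral_fluxSlope_nonneg (hk : IsMCPWeight K N D k) (hlam : 0 ≤ lam)
    (hf : IsModelEigenfunction p K N D lam f) (ha : 0 ≤ a) (hab : a ≤ b) (hb : b ≤ D / 2) :
    0 ≤ ∫ s in a..b, fluxSlope p lam k f s :=
  intervalIntegral_nonneg_of_Ioo hab fun _ hs =>
    hk.fluxSlope_nonneg hlam hf ⟨ha.trans_lt hs.1, hs.2.le.trans hb⟩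

lemma continuousOn_fluxSlope (hk : IsMCPWeight K N D k) (hp : 1 < p)
    (hf : IsModelEigenfunction p K N D lam f) :
    ContinuousOn (fluxSlope p lam k f) (Ioc 0 (D / 2)) := by
  intro x hx
  have hD : 0 ≤ D / 2 := hx.1.le.trans hx.2
  have hint := intervalIntegral.continuousOn_primitive_interval'
    (hk.intervalIntegrable_source hp hf le_rfl hD le_rfl) left_mem_uIcc
  rw [uIcc_of_le hD] at hint
  have hsub : Ioc 0 (D / 2) ⊆ Ioo 0 D := fun y hy => ⟨hy.1, by linarith [hy.1, hy.2]⟩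
  have hexp : 0 ≤ 1 / (p - 1) := one_div_nonneg.2 (by linarith)
  exact ((continuousOn_const.mul ((hint.mono Ioc_subset_Icc_self).div (hk.continuousOn.mono hsub)
    fun y hy => (hk.pos y (hsub hy)).ne')).rpow_const fun _ _ => Or.inr hexp) x hx

lemma integral_source_le (hk : IsMCPWeight K N D k) (hp : 1 < p) (hK : K ≤ 0) (hN : 1 < N)
    (hf : IsModelEigenfunction p K N D lam f) (ha : 0 ≤ a) (hab : a ≤ b) (hb0 : 0 < b)
    (hb : b ≤ D / 2) :
    ∫ t in a..b, k t * f t ^ (p - 1) ≤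
      k b / leftModel K N D b * ∫ t in a..b, leftModel K N D t * f t ^ (p - 1) := by
  have hm := isMCPWeight_leftModel (D := D) hK hN
  rw [← intervalIntegral.integral_const_mul]
  refine intervalIntegral.integral_mono_on_of_le_Ioo hab
    (hk.intervalIntegrable_source hp hf ha hab hb)
    ((hm.intervalIntegrable_source hp hf ha hab hb).const_mul _) fun t ht => ?_
  have ht0 : 0 < t := ha.trans_lt ht.1
  rw [← mul_assoc]
  refine mul_le_mul_of_nonneg_right ?_
    (Real.rpow_nonneg (hf.nonneg ⟨ht0.le, ht.2.le.trans hb⟩) _)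
  rw [div_mul_eq_mul_div, le_div_iff₀ (hm.pos_of_le_half ⟨hb0, hb⟩)]
  exact hk.mono t b ht0 ht.2.le (by linarith)

lemma meanFlux_le_of_gain (hk : IsMCPWeight K N D k) (hp : 1 < p) (hK : K ≤ 0) (hN : 1 < N)
    (hf : IsModelEigenfunction p K N D lam f) (hτ : 0 < τ) (hτs : τ ≤ s) (hs : s ≤ D / 2)
    (hd : k τ / leftModel K N D τ ≤ (1 - d) * (k s / leftModel K N D s)) :
    meanFlux p k f s ≤ ((∫ t in (0 : ℝ)..s, leftModel K N D t * f t ^ (p - 1)) -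
      d * ∫ t in (0 : ℝ)..τ, leftModel K N D t * f t ^ (p - 1)) / leftModel K N D s := by
  have hs0 : 0 < s := hτ.trans_le hτs
  have hτD : τ ≤ D / 2 := hτs.trans hs
  have hm := isMCPWeight_leftModel (D := D) hK hN
  have hsource : 0 ≤ ∫ t in (0 : ℝ)..τ, leftModel K N D t * f t ^ (p - 1) :=
    intervalIntegral_nonneg_of_Ioo hτ.le fun t ht =>
      hm.source_nonneg hf ⟨ht.1, ht.2.le.trans hτD⟩
  have hleft := (hk.integral_source_le hp hK hN hf le_rfl hτ.le hτ hτD).trans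
    (mul_le_mul_of_nonneg_right hd hsource)
  have hright := hk.integral_source_le hp hK hN hf hτ.le hτs hs0 hs
  rw [meanFlux, div_le_iff₀ (hk.pos_of_le_half ⟨hs0, hs⟩), div_mul_comm,
    ← intervalIntegral.integral_add_adjacent_intervals
      (hk.intervalIntegrable_source hp hf le_rfl hτ.le hτD)
      (hk.intervalIntegrable_source hp hf hτ.le hτs hs),
    ← intervalIntegral.integral_add_adjacent_intervals
      (hm.intervalIntegrable_source hp hf le_rfl hτ.le hτD)
      (hm.intervalIntegrable_source hp hf hτ.le hτs hs)]
  linarith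

lemma meanFlux_le (hk : IsMCPWeight K N D k) (hp : 1 < p) (hK : K ≤ 0) (hN : 1 < N)
    (hf : IsModelEigenfunction p K N D lam f) (hs : s ∈ Ioc 0 (D / 2)) :
    meanFlux p k f s ≤ meanFlux p (leftModel K N D) f s := by
  simpa only [meanFlux, zero_mul, sub_zero] using
    hk.meanFlux_le_of_gain (d := 0) hp hK hN hf hs.1 le_rfl hs.2 (by simp)

end IsMCPWeight

lemma fluxSlope_le_mul (hp : 1 < p) (hlam : 0 ≤ lam) (hc : 0 ≤ c) (hk : 0 ≤ meanFlux p k f s)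
    (hm : 0 ≤ meanFlux p m f s) (h : meanFlux p k f s ≤ c * meanFlux p m f s) :
    fluxSlope p lam k f s ≤ c ^ (1 / (p - 1)) * fluxSlope p lam m f s := by
  rw [fluxSlope, fluxSlope, ← Real.mul_rpow hc (mul_nonneg hlam hm), mul_left_comm]
  exact Real.rpow_le_rpow (mul_nonneg hlam hk) (mul_le_mul_of_nonneg_left h hlam)
    (one_div_nonneg.2 (by linarith))

lemma IsMCPWeight.fluxSlope_le (hk : IsMCPWeight K N D k) (hp : 1 < p) (hK : K ≤ 0) (hN : 1 < N)
    (hlam : 0 ≤ lam) (hf : IsModelEigenfunction p K N D lam f) (hs : s ∈ Ioc 0 (D / 2)) :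
    fluxSlope p lam k f s ≤ fluxSlope p lam (leftModel K N D) f s := by
  simpa only [Real.one_rpow, one_mul] using fluxSlope_le_mul hp hlam zero_le_one
    (hk.meanFlux_nonneg hf hs) ((isMCPWeight_leftModel hK hN).meanFlux_nonneg hf hs)
    ((hk.meanFlux_le hp hK hN hf hs).trans_eq (one_mul _).symm)

lemma IsModelEigenfunction.intervalIntegrable_fluxSlope (hf : IsModelEigenfunction p K N D lam f)
    (ha : 0 ≤ a) (hab : a ≤ b) (hb : b ≤ D / 2) :
    IntervalIntegrable (fluxSlope p lam (leftModel K N D) f) volume a b := by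
  rcases hab.eq_or_lt with rfl | hlt
  · exact IntervalIntegrable.refl
  have hD : 0 < D / 2 := (ha.trans_lt hlt).trans_le hb
  -- a nonintegrable slope would have integral `0`, but the integral is `f 0`
  have hint : IntervalIntegrable (fluxSlope p lam (leftModel K N D) f) volume 0 (D / 2) :=
    intervalIntegral.intervalIntegrable_of_integral_ne_zero
      (hf.eq_integral 0 (left_mem_Icc.2 hD.le) ▸ (hf.pos 0 (left_mem_Ico.2 hD)).ne')
  refine hint.mono_set ?_
  rw [uIcc_of_le hab, uIcc_of_le hD.le]
  exact Icc_subset_Icc ha hb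

lemma IsModelEigenfunction.integral_fluxSlope (hf : IsModelEigenfunction p K N D lam f)
    (hx : 0 ≤ x) (hxy : x ≤ y) (hy : y ≤ D / 2) :
    ∫ s in x..y, fluxSlope p lam (leftModel K N D) f s = f x - f y := by
  rw [hf.eq_integral x ⟨hx, hxy.trans hy⟩, hf.eq_integral y ⟨hx.trans hxy, hy⟩]
  exact eq_sub_of_add_eq (intervalIntegral.integral_add_adjacent_intervals
    (hf.intervalIntegrable_fluxSlope hx hxy hy)
    (hf.intervalIntegrable_fluxSlope (hx.trans hxy) hy le_rfl))

lemma IsModelEigenfunction.antitoneOn (hf : IsModelEigenfunction p K N D lam f) (hK : K ≤ 0)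
    (hN : 1 < N) (hlam : 0 ≤ lam) : AntitoneOn f (Icc 0 (D / 2)) := fun x hx y hy hxy => by
  have hint := (isMCPWeight_leftModel hK hN).integral_fluxSlope_nonneg hlam hf hx.1 hxy hy.2
  rw [hf.integral_fluxSlope hx.1 hxy hy.2] at hint
  exact sub_nonneg.1 hint

lemma IsMCPWeight.intervalIntegrable_fluxSlope (hk : IsMCPWeight K N D k) (hp : 1 < p)
    (hK : K ≤ 0) (hN : 1 < N) (hlam : 0 ≤ lam) (hf : IsModelEigenfunction p K N D lam f)
    (ha : 0 ≤ a) (hab : a ≤ b) (hb : b ≤ D / 2) :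
    IntervalIntegrable (fluxSlope p lam k f) volume a b := by
  have hsub : Ioc a b ⊆ Ioc 0 (D / 2) := Ioc_subset_Ioc ha hb
  refine (hf.intervalIntegrable_fluxSlope ha hab hb).mono_fun ?_ ?_ <;> rw [uIoc_of_le hab]
  · exact ((hk.continuousOn_fluxSlope hp hf).mono hsub).aestronglyMeasurable measurableSet_Ioc
  · refine ae_restrict_of_forall_mem measurableSet_Ioc fun s hs => ?_
    refine (Real.norm_of_nonneg (hk.fluxSlope_nonneg hlam hf (hsub hs))).trans_le ?_
    exact (hk.fluxSlope_le hp hK hN hlam hf (hsub hs)).trans (le_abs_self _)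

lemma IsMCPWeight.integral_fluxSlope_le_mul (hk : IsMCPWeight K N D k) (hp : 1 < p) (hK : K ≤ 0)
    (hN : 1 < N) (hlam : 0 ≤ lam) (hf : IsModelEigenfunction p K N D lam f)
    (hx : 0 ≤ x) (hxy : x ≤ y) (hy : y ≤ D / 2)
    (h : ∀ s ∈ Ioo x y, fluxSlope p lam k f s ≤ c * fluxSlope p lam (leftModel K N D) f s) :
    ∫ s in x..y, fluxSlope p lam k f s ≤ c * (f x - f y) := by
  rw [← hf.integral_fluxSlope hx hxy hy, ← intervalIntegral.integral_const_mul]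
  exact intervalIntegral.integral_mono_on_of_le_Ioo hxy
    (hk.intervalIntegrable_fluxSlope hp hK hN hlam hf hx hxy hy)
    ((hf.intervalIntegrable_fluxSlope hx hxy hy).const_mul c) h

lemma IsMCPWeight.integral_fluxSlope_le (hk : IsMCPWeight K N D k) (hp : 1 < p) (hK : K ≤ 0)
    (hN : 1 < N) (hlam : 0 ≤ lam) (hf : IsModelEigenfunction p K N D lam f)
    (hx : 0 ≤ x) (hxy : x ≤ y) (hy : y ≤ D / 2) :
    ∫ s in x..y, fluxSlope p lam k f s ≤ f x - f y := by
  simpa only [one_mul] using hk.integral_fluxSlope_le_mul (c := 1) hp hK hN hlam hf hx hxy hy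
    fun s hs => by
      rw [one_mul]
      exact hk.fluxSlope_le hp hK hN hlam hf ⟨hx.trans_lt hs.1, hs.2.le.trans hy⟩

lemma exists_halfPoincare_of_deficit (hp : 1 < p) (hK : K ≤ 0) (hN : 1 < N) (hlam : 0 < lam)
    (hf : IsModelEigenfunction p K N D lam f) (hk : IsMCPWeight K N D k) (ha : 0 < a)
    (haD : a ≤ D / 2) (hc : c ∈ Ioo 0 (D / 2)) (hη : η ∈ Ioo 0 1)
    (h : ∀ x ∈ Ioo 0 a, ∫ s in x..a, fluxSlope p lam k f s ≤ f x - η * f (max x c)) :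
    ∃ μ, lam < μ ∧ HalfPoincare p a μ k := by
  have hp1 : 0 < p - 1 := by linarith
  have hD : 0 < D / 2 := hc.1.trans hc.2
  have hf0 : 0 < f 0 := hf.pos 0 (left_mem_Ico.2 hD)
  have hfc : 0 < f c := hf.pos c (Ioo_subset_Ico_self hc)
  have hanti := hf.antitoneOn hK hN hlam.le
  have hf_le {x : ℝ} (hx : x ∈ Icc 0 (D / 2)) : f x ≤ f 0 := hanti (left_mem_Icc.2 hD.le) hx hx.1
  obtain ⟨ε, hε⟩ : ∃ ε, ε = η * (f c / f 0) := ⟨_, rfl⟩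
  have hratio : f c / f 0 ≤ 1 := (div_le_one hf0).2 (hf_le (Ioo_subset_Icc_self hc))
  have hε0 : 0 < ε := hε ▸ mul_pos hη.1 (div_pos hfc hf0)
  have hε1 : ε < 1 := by nlinarith [hη.1, hη.2]
  have hpow : 0 < (1 - ε) ^ (p - 1) := Real.rpow_pos_of_pos (by linarith) _
  have hpow1 : (1 - ε) ^ (p - 1) < 1 := Real.rpow_lt_one (by linarith) (by linarith) hp1
  refine ⟨lam / (1 - ε) ^ (p - 1), (lt_div_iff₀ hpow).2 (mul_lt_of_lt_one_right hlam hpow1),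
    halfPoincare_of_supersolution hp ha (by positivity) hlam
      (fun x hx => hk.pos_of_le_half ⟨hx.1, hx.2.le.trans haD⟩)
      (hk.intervalIntegrable_of_le le_rfl ha.le (by linarith))
      (hf.continuousOn.mono (Icc_subset_Icc_right haD))
      (fun x hx => hf.pos x ⟨hx.1.le, hx.2.trans_le haD⟩)
      (hk.intervalIntegrable_fluxSlope hp hK hN hlam.le hf le_rfl ha.le haD) fun x hx => ?_⟩
  have hxD : x ∈ Icc 0 (D / 2) := ⟨hx.1.le, hx.2.le.trans haD⟩
  have hfx : 0 ≤ f x := hf.nonneg hxD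
  have hmax : f c / f 0 * f x ≤ f (max x c) := by
    rcases le_total x c with hxc | hcx
    · rw [max_eq_right hxc, div_mul_comm]
      exact mul_le_of_le_one_left hfc.le ((div_le_one hf0).2 (hf_le hxD))
    · rw [max_eq_left hcx]
      exact mul_le_of_le_one_left hfx hratio
  have hbound : ∫ s in x..a, fluxSlope p lam k f s ≤ (1 - ε) * f x := by
    refine (h x hx).trans ?_
    rw [hε, sub_mul, one_mul, mul_assoc]
    exact sub_le_sub_left (mul_le_mul_of_nonneg_left hmax hη.1.le) _
  have hpow_le := Real.rpow_le_rpow (hk.integral_fluxSlope_nonneg hlam.le hf hx.1.le hx.2.le haD)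
    hbound hp1.le
  rw [Real.mul_rpow (by linarith) hfx] at hpow_le
  rw [div_mul_eq_mul_div, div_le_iff₀ hpow, mul_assoc, mul_comm (f x ^ _)]
  exact mul_le_mul_of_nonneg_left hpow_le hlam.le

lemma exists_halfPoincare_of_lt (hp : 1 < p) (hK : K ≤ 0) (hN : 1 < N) (hlam : 0 < lam)
    (hf : IsModelEigenfunction p K N D lam f) (hk : IsMCPWeight K N D k) (ha : 0 < a)
    (haD : a < D / 2) : ∃ μ, lam < μ ∧ HalfPoincare p a μ k := by
  have hfa : 0 < f a := hf.pos a ⟨ha.le, haD⟩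
  refine exists_halfPoincare_of_deficit (η := 1 / 2) hp hK hN hlam hf hk ha haD.le ⟨ha, haD⟩
    (by norm_num) fun x hx => ?_
  rw [max_eq_right hx.2.le]
  linarith [hk.integral_fluxSlope_le hp hK hN hlam.le hf hx.1.le hx.2.le haD.le]

lemma exists_meanFlux_le_mul (hp : 1 < p) (hK : K ≤ 0) (hN : 1 < N)
    (hf : IsModelEigenfunction p K N D lam f) (hk : IsMCPWeight K N D k) (hτ : 0 < τ)
    (hττ' : τ < τ') (hτ' : τ' < D / 2)
    (hlt : k τ / leftModel K N D τ < k τ' / leftModel K N D τ') :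
    ∃ δ ∈ Ioo 0 1, ∀ s ∈ Icc τ' (D / 2),
      meanFlux p k f s ≤ (1 - δ) * meanFlux p (leftModel K N D) f s := by
  have hm := isMCPWeight_leftModel (D := D) hK hN
  have hτD : τ < D / 2 := hττ'.trans hτ'
  have hratio : 0 < k τ / leftModel K N D τ :=
    div_pos (hk.pos_of_le_half ⟨hτ, hτD.le⟩) (hm.pos_of_le_half ⟨hτ, hτD.le⟩)
  have hratio' := hratio.trans hlt
  obtain ⟨d, hd⟩ : ∃ d, d = 1 - (k τ / leftModel K N D τ) / (k τ' / leftModel K N D τ') := ⟨_, rfl⟩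
  have hd0 : 0 < d := by linarith [(div_lt_one hratio').2 hlt]
  have hd1 : d < 1 := by linarith [div_pos hratio hratio']
  let I (s : ℝ) : ℝ := ∫ t in (0 : ℝ)..s, leftModel K N D t * f t ^ (p - 1)
  have hIτ : 0 < I τ := intervalIntegral.intervalIntegral_pos_of_pos_on
    (hm.intervalIntegrable_source hp hf le_rfl hτ.le hτD.le)
    (fun t ht => mul_pos (hm.pos_of_le_half ⟨ht.1, (ht.2.trans hτD).le⟩)
      (Real.rpow_pos_of_pos (hf.pos t ⟨ht.1.le, ht.2.trans hτD⟩) _)) hτ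
  have hIτD : I τ ≤ I (D / 2) := hm.integral_source_mono hp hf hτ.le hτD.le le_rfl
  have hID : 0 < I (D / 2) := hIτ.trans_le hIτD
  refine ⟨d * (I τ / I (D / 2)), ⟨by positivity, ?_⟩, fun s hs => ?_⟩
  · exact (mul_le_of_le_one_right hd0.le ((div_le_one hID).2 hIτD)).trans_lt hd1
  have hs0 : 0 < s := hτ.trans (hττ'.trans_le hs.1)
  have hms := hm.pos_of_le_half ⟨hs0, hs.2⟩
  have hgain : k τ / leftModel K N D τ ≤ (1 - d) * (k s / leftModel K N D s) := by
    have hmono : k τ' / leftModel K N D τ' ≤ k s / leftModel K N D s := by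
      rw [div_le_div_iff₀ (hm.pos_of_le_half ⟨hτ.trans hττ', hτ'.le⟩) hms]
      exact hk.mono τ' s (hτ.trans hττ') hs.1 (by linarith [hs.2])
    refine le_trans (le_of_eq ?_) (mul_le_mul_of_nonneg_left hmono (sub_pos.2 hd1).le)
    rw [hd, sub_sub_cancel, div_mul_cancel₀ _ hratio'.ne']
  refine (hk.meanFlux_le_of_gain hp hK hN hf hτ (hττ'.le.trans hs.1) hs.2 hgain).trans ?_
  have hIs : d * (I τ / I (D / 2)) * I s ≤ d * I τ := by
    rw [mul_assoc, div_mul_comm]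
    gcongr
    exact mul_le_of_le_one_left hIτ.le
      ((div_le_one hID).2 (hm.integral_source_mono hp hf hs0.le hs.2 le_rfl))
  rw [meanFlux, ← mul_div_assoc, sub_mul, one_mul]
  gcongr

lemma exists_fluxSlope_le_mul (hp : 1 < p) (hK : K ≤ 0) (hN : 1 < N) (hlam : 0 ≤ lam)
    (hf : IsModelEigenfunction p K N D lam f) (hk : IsMCPWeight K N D k) (hτ : 0 < τ)
    (hττ' : τ < τ') (hτ' : τ' < D / 2)
    (hlt : k τ / leftModel K N D τ < k τ' / leftModel K N D τ') :
    ∃ η ∈ Ioo 0 1, ∀ s ∈ Icc τ' (D / 2),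
      fluxSlope p lam k f s ≤ (1 - η) * fluxSlope p lam (leftModel K N D) f s := by
  obtain ⟨δ, hδ, hflux⟩ := exists_meanFlux_le_mul hp hK hN hf hk hτ hττ' hτ' hlt
  have hexp : 0 < 1 / (p - 1) := one_div_pos.2 (by linarith)
  refine ⟨1 - (1 - δ) ^ (1 / (p - 1)), ⟨?_, ?_⟩, fun s hs => ?_⟩
  · exact sub_pos.2 (Real.rpow_lt_one (by linarith [hδ.2]) (by linarith [hδ.1]) hexp)
  · exact sub_lt_self _ (Real.rpow_pos_of_pos (by linarith [hδ.2]) _)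
  · have hs' : s ∈ Ioc 0 (D / 2) := ⟨hτ.trans (hττ'.trans_le hs.1), hs.2⟩
    rw [sub_sub_cancel]
    exact fluxSlope_le_mul hp hlam (by linarith [hδ.2]) (hk.meanFlux_nonneg hf hs')
      ((isMCPWeight_leftModel hK hN).meanFlux_nonneg hf hs') (hflux s hs)

lemma exists_halfPoincare_of_gain (hp : 1 < p) (hK : K ≤ 0) (hN : 1 < N) (hlam : 0 < lam)
    (hf : IsModelEigenfunction p K N D lam f) (hk : IsMCPWeight K N D k) (hτ : 0 < τ)
    (hττ' : τ < τ') (hτ' : τ' < D / 2)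
    (hlt : k τ / leftModel K N D τ < k τ' / leftModel K N D τ') :
    ∃ μ, lam < μ ∧ HalfPoincare p (D / 2) μ k := by
  obtain ⟨η, hη, hslope⟩ := exists_fluxSlope_le_mul hp hK hN hlam.le hf hk hτ hττ' hτ' hlt
  have hτ'0 : 0 < τ' := hτ.trans hττ'
  refine exists_halfPoincare_of_deficit hp hK hN hlam hf hk (hτ'0.trans hτ') le_rfl ⟨hτ'0, hτ'⟩ hη
    fun x hx => ?_
  set y := max x τ'
  have hxy : x ≤ y := le_max_left _ _
  have hy0 : 0 ≤ y := hx.1.le.trans hxy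
  have hyD : y ≤ D / 2 := max_le hx.2.le hτ'.le
  have hleft := hk.integral_fluxSlope_le hp hK hN hlam.le hf hx.1.le hxy hyD
  have hright := hk.integral_fluxSlope_le_mul hp hK hN hlam.le hf hy0 hyD le_rfl
    fun s hs => hslope s ⟨(le_max_right x τ').trans hs.1.le, hs.2.le⟩
  have hfD := hf.nonneg (right_mem_Icc.2 (hy0.trans hyD))
  rw [← intervalIntegral.integral_add_adjacent_intervals
    (hk.intervalIntegrable_fluxSlope hp hK hN hlam.le hf hx.1.le hxy hyD)
    (hk.intervalIntegrable_fluxSlope hp hK hN hlam.le hf hy0 hyD le_rfl)]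
  nlinarith [hη.2]

end Comparison

/-! ### Stability of a strict constant under dilation -/

section Dilation

variable {p K N D κ a x y β δ μ lam B : ℝ} {k l : ℝ → ℝ}

lemma self_le_sK (hκ : κ ≤ 0) (hx : 0 ≤ x) : x ≤ sK κ x := by
  have hzero : sK κ 0 = 0 := by simp [sK]
  have hslope := mul_sub_le_image_sub_of_le_deriv (fun x => (hasDerivAt_sK hκ x).differentiableAt)
    (C := 1) (fun x => (hasDerivAt_sK hκ x).deriv ▸ Real.one_le_cosh _) hx
  simpa only [hzero, sub_zero, one_mul] using hslope

lemma sK_sub_le (hκ : κ ≤ 0) (hx : 0 ≤ x) (hxy : x ≤ y) (hy : y ≤ D) :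
    sK κ y - sK κ x ≤ Real.cosh (√(-κ) * D) * (y - x) := by
  have hD : 0 ≤ D := hx.trans (hxy.trans hy)
  refine (convex_Icc 0 D).image_sub_le_mul_sub_of_deriv_le (continuous_sK κ).continuousOn
    (fun t _ => (hasDerivAt_sK hκ t).differentiableAt.differentiableWithinAt) (fun t ht => ?_)
    x ⟨hx, hxy.trans hy⟩ y ⟨hx.trans hxy, hy⟩ hxy
  rw [interior_Icc] at ht
  have ht0 : 0 ≤ t := ht.1.le
  rw [(hasDerivAt_sK hκ t).deriv, Real.cosh_le_cosh, abs_of_nonneg (by positivity),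
    abs_of_nonneg (by positivity)]
  exact mul_le_mul_of_nonneg_left ht.2.le (Real.sqrt_nonneg _)

/-- Bound for the relative increase of `s_κ^{N-1}` on `[0, D]` when its argument increases by the
relative amount `δ`. -/
noncomputable def distortionBound (K N D δ : ℝ) : ℝ :=
  (1 + Real.cosh (√(-(K / (N - 1))) * D) * δ) ^ (N - 1)

lemma distortionBound_pos (hδ : 0 ≤ δ) : 0 < distortionBound K N D δ :=
  Real.rpow_pos_of_pos (add_pos_of_pos_of_nonneg one_pos (mul_nonneg (Real.cosh_pos _).le hδ)) _

lemma sK_rpow_le_distortionBound_mul (hK : K ≤ 0) (hN : 1 < N) (hx : 0 < x) (hxy : x ≤ y)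
    (hy : y ≤ D) (hδ : y - x ≤ δ * x) :
    sK (K / (N - 1)) y ^ (N - 1) ≤
      distortionBound K N D δ * sK (K / (N - 1)) x ^ (N - 1) := by
  have hκ := curvature_nonpos hK hN
  have hC := Real.cosh_pos (√(-(K / (N - 1))) * D)
  have hδ0 : 0 ≤ δ := nonneg_of_mul_nonneg_left ((sub_nonneg.2 hxy).trans hδ) hx
  have hlin : sK (K / (N - 1)) y ≤
      (1 + Real.cosh (√(-(K / (N - 1))) * D) * δ) * sK (K / (N - 1)) x := by
    have hincr : y - x ≤ δ * sK (K / (N - 1)) x :=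
      hδ.trans (mul_le_mul_of_nonneg_left (self_le_sK hκ hx.le) hδ0)
    linarith [sK_sub_le hκ hx.le hxy hy, mul_le_mul_of_nonneg_left hincr hC.le]
  rw [distortionBound, ← Real.mul_rpow (by positivity) (sK_pos hκ hx).le]
  exact Real.rpow_le_rpow (sK_pos hκ (hx.trans_le hxy)).le hlin (by linarith)

lemma IsMCPWeight.le_distortionBound_mul_of_le (hk : IsMCPWeight K N D k) (hK : K ≤ 0) (hN : 1 < N)
    (hx : 0 < x) (hxy : x ≤ y) (hy : y < D) (hδ : y - x ≤ δ * x) :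
    k y ≤ distortionBound K N D δ * k x := by
  have hsx : 0 < sK (K / (N - 1)) x ^ (N - 1) :=
    Real.rpow_pos_of_pos (sK_pos (curvature_nonpos hK hN) hx) _
  refine le_of_mul_le_mul_right ((hk.anti x y hx hxy hy).trans ?_) hsx
  rw [mul_right_comm, mul_comm]
  exact mul_le_mul_of_nonneg_right (sK_rpow_le_distortionBound_mul hK hN hx hxy hy.le hδ)
    (hk.pos x ⟨hx, hxy.trans_lt hy⟩).le

lemma IsMCPWeight.le_distortionBound_mul_of_ge (hk : IsMCPWeight K N D k) (hK : K ≤ 0) (hN : 1 < N)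
    (hx : 0 < x) (hxy : x ≤ y) (hy : y < D) (hδ : y - x ≤ δ * (D - y)) :
    k x ≤ distortionBound K N D δ * k y := by
  refine le_of_mul_le_mul_right ((hk.mono x y hx hxy hy).trans ?_) (leftModel_pos hK hN hy)
  rw [mul_right_comm, mul_comm]
  exact mul_le_mul_of_nonneg_right (sK_rpow_le_distortionBound_mul hK hN (sub_pos.2 hy)
    (by linarith) (by linarith) (by linarith)) (hk.pos y ⟨hx.trans_le hxy, hy⟩).le

lemma HalfPoincare.dilate (h : HalfPoincare p a μ k) (hβ : 0 < β) :
    HalfPoincare p (β * a) (μ / β ^ p) (fun x => k (β⁻¹ * x)) := by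
  rintro u ⟨C, hu⟩ hua
  have hscale : LipschitzWith (‖β‖₊) fun x : ℝ => β * x := lipschitzWith_smul β
  have key := h (fun x => u (β * x)) ⟨_, hu.comp hscale⟩ hua
  have hleft := intervalIntegral.integral_comp_mul_left (a := 0) (b := a)
    (fun x => |u x| ^ p * k (β⁻¹ * x)) hβ.ne'
  have hright := intervalIntegral.integral_comp_mul_left (a := 0) (b := a)
    (fun x => |deriv u x| ^ p * k (β⁻¹ * x)) hβ.ne'
  simp only [inv_mul_cancel_left₀ hβ.ne', mul_zero, smul_eq_mul] at hleft hright
  simp only [deriv_comp_mul_left, smul_eq_mul, abs_mul, abs_of_pos hβ,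
    Real.mul_rpow hβ.le (abs_nonneg _), mul_assoc, intervalIntegral.integral_const_mul] at key
  rw [hleft, hright, mul_left_comm, mul_left_comm (β ^ p)] at key
  rw [div_mul_eq_mul_div, div_le_iff₀' (Real.rpow_pos_of_pos hβ p)]
  exact le_of_mul_le_mul_left key (inv_pos.2 hβ)

lemma HalfPoincare.of_comparable (h : HalfPoincare p a μ k) (hp : 0 ≤ p) (ha : 0 ≤ a) (hμ : 0 ≤ μ)
    (hB : 0 < B) (hk : IntervalIntegrable k volume 0 a) (hl : IntervalIntegrable l volume 0 a)
    (hlk : ∀ x ∈ Ioo 0 a, l x ≤ B * k x) (hkl : ∀ x ∈ Ioo 0 a, k x ≤ B * l x) :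
    HalfPoincare p a (μ / B ^ 2) l := by
  rintro u ⟨C, hu⟩ hua
  have hle {w k₁ k₂ : ℝ → ℝ} (hw : ∀ x, 0 ≤ w x)
      (h₁ : IntervalIntegrable (fun x => w x * k₁ x) volume 0 a)
      (h₂ : IntervalIntegrable (fun x => w x * k₂ x) volume 0 a)
      (h₁₂ : ∀ x ∈ Ioo 0 a, k₁ x ≤ B * k₂ x) :
      ∫ x in (0 : ℝ)..a, w x * k₁ x ≤ B * ∫ x in (0 : ℝ)..a, w x * k₂ x := by
    rw [← intervalIntegral.integral_const_mul]
    refine intervalIntegral.integral_mono_on_of_le_Ioo ha h₁ (h₂.const_mul B) fun x hx => ?_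
    rw [mul_left_comm]
    exact mul_le_mul_of_nonneg_left (h₁₂ x hx) (hw x)
  rw [div_mul_eq_mul_div, div_le_iff₀' (by positivity)]
  calc μ * ∫ x in (0 : ℝ)..a, |u x| ^ p * l x
      ≤ μ * (B * ∫ x in (0 : ℝ)..a, |u x| ^ p * k x) :=
        mul_le_mul_of_nonneg_left (hle (fun _ => by positivity)
          (intervalIntegrable_abs_rpow_mul hp hu.continuous hl)
          (intervalIntegrable_abs_rpow_mul hp hu.continuous hk) hlk) hμ
    _ = B * (μ * ∫ x in (0 : ℝ)..a, |u x| ^ p * k x) := mul_left_comm _ _ _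
    _ ≤ B * (B * ∫ x in (0 : ℝ)..a, |deriv u x| ^ p * l x) :=
        mul_le_mul_of_nonneg_left ((h u ⟨C, hu⟩ hua).trans (hle (fun _ => by positivity)
          (intervalIntegrable_abs_deriv_rpow_mul hp hu hk)
          (intervalIntegrable_abs_deriv_rpow_mul hp hu hl) hkl)) hB.le
    _ = B ^ 2 * ∫ x in (0 : ℝ)..a, |deriv u x| ^ p * l x := by ring

lemma IsMCPWeight.halfPoincare_dilate (hk : IsMCPWeight K N D k) (hp : 0 ≤ p) (hK : K ≤ 0)
    (hN : 1 < N) (hD : 0 < D) (hμ : 0 ≤ μ) (hβ : 1 ≤ β) (hβ' : β ≤ 3 / 2)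
    (h : HalfPoincare p (D / 2) μ k) :
    HalfPoincare p (β * (D / 2))
      (μ / β ^ p / distortionBound K N D (2 * (β - 1)) ^ 2) k := by
  have hβ0 : 0 < β := by linarith
  have hend : β * (D / 2) ≤ D := by nlinarith
  have hδ : 0 ≤ 2 * (β - 1) := by linarith
  have hdil : IntervalIntegrable (fun x => k (β⁻¹ * x)) volume 0 (β * (D / 2)) := by
    simpa only [zero_div, div_inv_eq_mul, mul_comm, mul_zero, zero_mul] using
      (hk.intervalIntegrable_of_le le_rfl (by linarith : 0 ≤ D / 2) (by linarith)).comp_mul_left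
        (c := β⁻¹)
  refine (h.dilate hβ0).of_comparable hp (by positivity) (by positivity) (distortionBound_pos hδ)
    hdil (hk.intervalIntegrable_of_le le_rfl (by positivity) hend) ?_ ?_
  all_goals
    intro x hx
    obtain ⟨y, rfl⟩ : ∃ y, x = β * y := ⟨β⁻¹ * x, (mul_inv_cancel_left₀ hβ0.ne' x).symm⟩
    have hy0 : 0 < y := pos_of_mul_pos_right hx.1 hβ0.le
    have hyD : y < D / 2 := lt_of_mul_lt_mul_left hx.2 hβ0.le
    have hyβ : y ≤ β * y := le_mul_of_one_le_left hy0.le hβ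
    rw [inv_mul_cancel_left₀ hβ0.ne']
  · exact hk.le_distortionBound_mul_of_le hK hN hy0 hyβ (hx.2.trans_le hend) (by nlinarith)
  · exact hk.le_distortionBound_mul_of_ge hK hN hy0 hyβ (hx.2.trans_le hend) (by nlinarith)

lemma IsMCPWeight.exists_longer_halfPoincare (hk : IsMCPWeight K N D k) (hp : 0 ≤ p) (hK : K ≤ 0)
    (hN : 1 < N) (hD : 0 < D) (hlam : 0 ≤ lam) (hμ : lam < μ) (h : HalfPoincare p (D / 2) μ k) :
    ∃ a ∈ Ioo (D / 2) D, ∃ ν, lam < ν ∧ HalfPoincare p a ν k := by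
  have hbase : ContinuousAt (fun β => distortionBound K N D (2 * (β - 1))) 1 :=
    ContinuousAt.rpow_const (by fun_prop) (Or.inr (by linarith))
  have hcont : ContinuousAt
      (fun β : ℝ => μ / β ^ p / distortionBound K N D (2 * (β - 1)) ^ 2) 1 :=
    (continuousAt_const.div (continuousAt_id.rpow_const (Or.inl one_ne_zero)) (by simp)).div
      (hbase.pow 2) (by simp [distortionBound])
  have hconst : ∀ᶠ β in nhdsWithin (1 : ℝ) (Ioi 1),
      lam < μ / β ^ p / distortionBound K N D (2 * (β - 1)) ^ 2 :=
    (hcont.eventually_const_lt (by simpa [distortionBound] using hμ)).filter_mono nhdsWithin_le_nhds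
  obtain ⟨β, hν, hβ⟩ := (hconst.and (Ioo_mem_nhdsGT (by norm_num : (1 : ℝ) < 3 / 2))).exists
  exact ⟨β * (D / 2), ⟨by nlinarith [hβ.1], by nlinarith [hβ.2]⟩, _, hν,
    hk.halfPoincare_dilate hp hK hN hD (hlam.trans hμ.le) hβ.1.le hβ.2.le h⟩

end Dilation

/-! ### MCP densities as weights -/

section Density

variable {K N D x y : ℝ} {h k : ℝ → ℝ}

lemma distortion_eq {κ t θ : ℝ} (hκ : κ ≤ 0) (hθ : 0 < θ) :
    distortion κ t θ = sK κ (t * θ) / sK κ θ := by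
  rcases hκ.eq_or_lt with rfl | hlt
  · simp only [distortion, sK, zero_mul, if_true, mul_div_cancel_right₀ _ hθ.ne']
  · have hr : √(-κ) ≠ 0 := (Real.sqrt_pos.2 (neg_pos.2 hlt)).ne'
    have hne : κ * θ ^ 2 ≠ 0 := mul_ne_zero hlt.ne (pow_ne_zero 2 hθ.ne')
    simp only [distortion, sK, if_neg hne, if_neg hlt.ne, div_div_div_cancel_right₀ hr,
      mul_comm (√(-κ))]

lemma density_contraction (hK : K ≤ 0) (hN : 1 < N) (hh : h ∈ densityClass K N D) {x₀ x₁ s : ℝ}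
    (h₀ : x₀ ∈ Icc 0 D) (h₁ : x₁ ∈ Icc 0 D) (hne : x₁ ≠ x₀) (hs : s ∈ Icc (0 : ℝ) 1) :
    h x₀ * sK (K / (N - 1)) (s * |x₁ - x₀|) ^ (N - 1) ≤
      h ((1 - s) * x₁ + s * x₀) * sK (K / (N - 1)) |x₁ - x₀| ^ (N - 1) := by
  have hκ := curvature_nonpos hK hN
  have hθ : 0 < |x₁ - x₀| := abs_pos.2 (sub_ne_zero.2 hne)
  have hpos := sK_pos hκ hθ
  have hsθ : 0 ≤ s * |x₁ - x₀| := mul_nonneg hs.1 hθ.le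
  have hcontr := hh.1.contraction x₀ (hh.2 ▸ h₀) x₁ (hh.2 ▸ h₁) (1 - s)
    ⟨sub_nonneg.2 hs.2, sub_le_self 1 hs.1⟩
  rwa [sub_sub_cancel, distortion_eq hκ hθ, Real.div_rpow (hsθ.trans (self_le_sK hκ hsθ)) hpos.le,
    div_mul_eq_mul_div, div_le_iff₀ (Real.rpow_pos_of_pos hpos _), mul_comm (_ ^ _) (h x₀)]
    at hcontr

lemma density_mul_sK_rpow_le (hK : K ≤ 0) (hN : 1 < N) (hh : h ∈ densityClass K N D)
    (hx : 0 < x) (hxy : x ≤ y) (hy : y < D) :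
    h y * sK (K / (N - 1)) x ^ (N - 1) ≤ h x * sK (K / (N - 1)) y ^ (N - 1) := by
  have hy0 : 0 < y := hx.trans_le hxy
  have hcontr := density_contraction hK hN hh (x₀ := y) (x₁ := 0) (s := x / y) ⟨hy0.le, hy.le⟩
    ⟨le_rfl, (hy0.trans hy).le⟩ hy0.ne ⟨by positivity, (div_le_one hy0).2 hxy⟩
  rwa [zero_sub, abs_neg, abs_of_pos hy0, mul_zero, zero_add, div_mul_cancel₀ _ hy0.ne'] at hcontr

lemma density_mul_leftModel_le (hK : K ≤ 0) (hN : 1 < N) (hh : h ∈ densityClass K N D)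
    (hx : 0 < x) (hxy : x ≤ y) (hy : y < D) :
    h x * leftModel K N D y ≤ h y * leftModel K N D x := by
  have hDx : 0 < D - x := by linarith
  have hcontr := density_contraction hK hN hh (x₀ := x) (x₁ := D) (s := (D - y) / (D - x))
    ⟨hx.le, by linarith⟩ ⟨by linarith, le_rfl⟩ (by linarith)
    ⟨div_nonneg (by linarith) hDx.le, (div_le_one hDx).2 (by linarith)⟩
  have hpoint : (1 - (D - y) / (D - x)) * D + (D - y) / (D - x) * x = y := by field_simp; ring
  rwa [abs_of_pos hDx, div_mul_cancel₀ _ hDx.ne', hpoint] at hcontr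

lemma density_pos (hK : K ≤ 0) (hN : 1 < N) (hh : h ∈ densityClass K N D) (hy : y ∈ Ioo 0 D) :
    0 < h y := by
  have hD : 0 < D := hy.1.trans hy.2
  have hκ := curvature_nonpos hK hN
  have hmid : D / 2 ∈ closure (Function.support h) := by
    change D / 2 ∈ tsupport h
    rw [hh.2]
    constructor <;> linarith
  obtain ⟨z, hz, hz0⟩ := mem_closure_iff.1 hmid (Ioo 0 D) isOpen_Ioo ⟨by linarith, by linarith⟩
  have hhz : 0 < h z := (hh.1.nonneg z).lt_of_ne' hz0
  rcases le_total y z with hyz | hzy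
  · exact pos_of_mul_pos_left ((mul_pos hhz (Real.rpow_pos_of_pos (sK_pos hκ hy.1) _)).trans_le
      (density_mul_sK_rpow_le hK hN hh hy.1 hyz hz.2)) (Real.rpow_nonneg (sK_pos hκ hz.1).le _)
  · exact pos_of_mul_pos_left ((mul_pos hhz (leftModel_pos hK hN hy.2)).trans_le
      (density_mul_leftModel_le hK hN hh hz.1 hzy hy.2)) (leftModel_pos hK hN hz.2).le

-- Near `y`, `f` is squeezed between the multiples of `A` and `B` which agree with `f` at `y`.
lemma continuousAt_of_mul_le_mul {f A B : ℝ → ℝ} {s : Set ℝ} (hs : s ∈ nhds y)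
    (hA : ContinuousAt A y) (hB : ContinuousAt B y) (hAy : 0 < A y) (hBy : 0 < B y)
    (hanti : ∀ x ∈ s, ∀ z ∈ s, x ≤ z → f z * A x ≤ f x * A z)
    (hmono : ∀ x ∈ s, ∀ z ∈ s, x ≤ z → f x * B z ≤ f z * B x) : ContinuousAt f y := by
  have hys := mem_of_mem_nhds hs
  have hAt : Filter.Tendsto (fun z => f y * A z / A y) (nhds y) (nhds (f y)) := by
    simpa only [ContinuousAt, mul_div_cancel_right₀ _ hAy.ne'] using
      (hA.const_mul (f y)).div_const (A y)
  have hBt : Filter.Tendsto (fun z => f y * B z / B y) (nhds y) (nhds (f y)) := by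
    simpa only [ContinuousAt, mul_div_cancel_right₀ _ hBy.ne'] using
      (hB.const_mul (f y)).div_const (B y)
  refine tendsto_of_tendsto_of_tendsto_of_le_of_le' (min_self (f y) ▸ hAt.min hBt)
    (max_self (f y) ▸ hAt.max hBt) ?_ ?_ <;> filter_upwards [hs] with z hz
  · rcases le_total y z with hyz | hzy
    · exact min_le_of_right_le ((div_le_iff₀ hBy).2 (hmono y hys z hz hyz))
    · exact min_le_of_left_le ((div_le_iff₀ hAy).2 (hanti z hz y hys hzy))
  · rcases le_total y z with hyz | hzy
    · exact le_max_of_le_left ((le_div_iff₀ hAy).2 (hanti y hys z hz hyz))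
    · exact le_max_of_le_right ((le_div_iff₀ hBy).2 (hmono z hz y hys hzy))

lemma continuousAt_density (hK : K ≤ 0) (hN : 1 < N) (hh : h ∈ densityClass K N D)
    (hy : y ∈ Ioo 0 D) : ContinuousAt h y :=
  continuousAt_of_mul_le_mul (A := fun z => sK (K / (N - 1)) z ^ (N - 1)) (B := leftModel K N D)
    (Ioo_mem_nhds hy.1 hy.2)
    ((continuous_sK _).continuousAt.rpow_const (Or.inr (sub_nonneg.2 hN.le)))
    (continuous_leftModel hN).continuousAt
    (Real.rpow_pos_of_pos (sK_pos (curvature_nonpos hK hN) hy.1) _) (leftModel_pos hK hN hy.2)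
    (fun _ hx _ hz hxz => density_mul_sK_rpow_le hK hN hh hx.1 hxz hz.2)
    fun _ hx _ hz hxz => density_mul_leftModel_le hK hN hh hx.1 hxz hz.2

lemma isMCPWeight_of_mem_densityClass (hK : K ≤ 0) (hN : 1 < N) (hh : h ∈ densityClass K N D) :
    IsMCPWeight K N D h where
  pos _ hx := density_pos hK hN hh hx
  continuousOn _ hx := (continuousAt_density hK hN hh hx).continuousWithinAt
  intervalIntegrable := hh.1.integrable.intervalIntegrable
  mono _ _ hx hxy hy := density_mul_leftModel_le hK hN hh hx hxy hy
  anti _ _ hx hxy hy := density_mul_sK_rpow_le hK hN hh hx hxy hy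

lemma IsMCPWeight.reflect (hk : IsMCPWeight K N D k) : IsMCPWeight K N D fun x => k (D - x) where
  pos x hx := hk.pos _ ⟨by linarith [hx.2], by linarith [hx.1]⟩
  continuousOn := hk.continuousOn.comp (continuous_const.sub continuous_id).continuousOn
    fun x hx => ⟨by simpa using hx.2, by simpa using hx.1⟩
  intervalIntegrable := by simpa using (hk.intervalIntegrable.comp_sub_left D).symm
  mono x y hx hxy hy := hk.anti (D - y) (D - x) (by linarith) (by linarith) (by linarith)
  anti x y hx hxy hy := by
    simpa [leftModel] using hk.mono (D - y) (D - x) (by linarith) (by linarith) (by linarith)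

end Density

/-! ### Lower bounds for the spectral gap -/

section Power

variable {p : ℝ}

lemma continuous_mul_abs_rpow (hp : 1 < p) : Continuous fun t : ℝ => t * |t| ^ (p - 2) := by
  have hderiv : Continuous (deriv fun t : ℝ => |t| ^ p) :=
    (contDiff_norm_rpow (E := ℝ) hp).continuous_deriv le_rfl
  refine (hderiv.div_const p).congr fun t => ?_
  rw [(hasDerivAt_abs_rpow t hp).deriv]
  field_simp

lemma abs_mul_abs_rpow (hp : 1 < p) (t : ℝ) : |t * |t| ^ (p - 2)| = |t| ^ (p - 1) := by
  rw [abs_mul, abs_of_nonneg (by positivity : 0 ≤ |t| ^ (p - 2))]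
  rcases (abs_nonneg t).eq_or_lt with h | h
  · rw [← h, zero_mul, Real.zero_rpow (by linarith)]
  · rw [show p - 1 = p - 2 + 1 by ring, Real.rpow_add_one h.ne', mul_comm]

lemma mul_mul_abs_rpow (hp : 0 < p) (t : ℝ) : t * (t * |t| ^ (p - 2)) = |t| ^ p := by
  rcases eq_or_ne t 0 with rfl | h
  · simp [Real.zero_rpow hp.ne']
  · rw [← mul_assoc, ← sq, ← sq_abs, mul_comm, ← Real.rpow_natCast,
      ← Real.rpow_add (abs_pos.2 h), Nat.cast_ofNat, sub_add_cancel]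

-- Convexity of `|·| ^ p`, whose tangent at `t` has slope `p * (t * |t| ^ (p - 2))`.
lemma abs_rpow_le_abs_sub_rpow_add (hp : 1 < p) (t c : ℝ) :
    |t| ^ p ≤ |t - c| ^ p + p * c * (t * |t| ^ (p - 2)) := by
  have hp0 : 0 < p := by linarith
  have hp1 : 0 < p - 1 := by linarith
  have hyoung := Real.young_inequality_of_nonneg (abs_nonneg (t - c))
    (by positivity : 0 ≤ |t| ^ (p - 1)) (Real.HolderConjugate.conjExponent hp)
  rw [← Real.rpow_mul (abs_nonneg t), show p.conjExponent = p / (p - 1) from rfl,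
    mul_div_cancel₀ _ hp1.ne'] at hyoung
  have hprod : (t - c) * (t * |t| ^ (p - 2)) ≤ |t - c| * |t| ^ (p - 1) := by
    rw [← abs_mul_abs_rpow hp t, ← abs_mul]
    exact le_abs_self _
  have hscaled : |t - c| * |t| ^ (p - 1) * p ≤ |t - c| ^ p + (p - 1) * |t| ^ p := by
    refine (mul_le_mul_of_nonneg_right hyoung hp0.le).trans_eq ?_
    field_simp
  nlinarith [mul_mul_abs_rpow hp0 t]

end Power

section SpectralGap

variable {p K N D a b μ μ' : ℝ} {h k u g : ℝ → ℝ} {C : NNReal}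

lemma exists_integral_sub_mul_abs_sub_rpow_eq_zero (hp : 1 < p) (hab : a ≤ b)
    (hk : IntervalIntegrable k volume a b) (hk0 : ∀ x ∈ Icc a b, 0 ≤ k x) :
    ∃ c ∈ Icc a b, ∫ x in a..b, (x - c) * |x - c| ^ (p - 2) * k x = 0 := by
  have hψ := continuous_mul_abs_rpow hp
  have hcont : ContinuousOn (fun c => ∫ x in a..b, (x - c) * |x - c| ^ (p - 2) * k x)
      (Icc a b) := by
    intro c _
    refine intervalIntegral.continuousWithinAt_of_dominated_interval
      (bound := fun x => (b - a) ^ (p - 1) * k x) (.of_forall fun c => ?_)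
      (Filter.eventually_of_mem self_mem_nhdsWithin fun c hc => .of_forall fun x hx => ?_)
      (hk.const_mul _) (.of_forall fun x _ => ?_)
    · exact (hk.continuousOn_mul
        (hψ.comp (continuous_id.sub continuous_const)).continuousOn).def'.aestronglyMeasurable
    · rw [uIoc_of_le hab] at hx
      have hkx := hk0 x (Ioc_subset_Icc_self hx)
      rw [norm_mul, Real.norm_of_nonneg hkx, Real.norm_eq_abs, abs_mul_abs_rpow hp]
      have hdist : |x - c| ≤ b - a :=
        abs_le.2 ⟨by linarith [hx.1, hc.2], by linarith [hx.2, hc.1]⟩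
      gcongr
    · exact ((hψ.comp (continuous_const.sub continuous_id)).mul
        continuous_const).continuousWithinAt
  have hleft : 0 ≤ ∫ x in a..b, (x - a) * |x - a| ^ (p - 2) * k x :=
    intervalIntegral.integral_nonneg hab fun x hx =>
      mul_nonneg (mul_nonneg (sub_nonneg.2 hx.1) (by positivity)) (hk0 x hx)
  have hright : ∫ x in a..b, (x - b) * |x - b| ^ (p - 2) * k x ≤ 0 := by
    rw [intervalIntegral.integral_of_le hab]
    exact setIntegral_nonpos measurableSet_Ioc fun x hx =>
      mul_nonpos_of_nonpos_of_nonneg (mul_nonpos_of_nonpos_of_nonneg (sub_nonpos.2 hx.2)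
        (by positivity)) (hk0 x (Ioc_subset_Icc_self hx))
  exact intermediate_value_Icc' hab hcont ⟨hright, hleft⟩

lemma integral_mul_density (hD : 0 ≤ D) (hh : h ∈ densityClass K N D) (g : ℝ → ℝ) :
    ∫ x, g x * h x = ∫ x in (0 : ℝ)..D, g x * h x := by
  rw [intervalIntegral.integral_of_le hD, ← integral_Icc_eq_integral_Ioc]
  refine (setIntegral_eq_integral_of_forall_compl_eq_zero fun x hx => ?_).symm
  rw [← hh.2] at hx
  rw [image_eq_zero_of_notMem_tsupport hx, mul_zero]

lemma integrable_mul_density (hh : h ∈ densityClass K N D) (hg : ContinuousOn g (Icc 0 D)) :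
    Integrable fun x => g x * h x := by
  have hsupp : Function.support (fun x => g x * h x) ⊆ Icc 0 D := fun x hx => by
    rw [← hh.2]
    exact subset_tsupport _ (right_ne_zero_of_mul hx)
  rw [← integrableOn_iff_integrable_of_support_subset hsupp]
  exact hh.1.integrable.integrableOn.continuousOn_mul hg isCompact_Icc

lemma exists_admissible (hp : 1 < p) (hD : 0 < D) (hh : h ∈ densityClass K N D) :
    ∃ u : ℝ → ℝ, (∃ C, LipschitzWith C u) ∧ Integrable (fun x => |u x| ^ p * h x) ∧
      ∫ x, u x * |u x| ^ (p - 2) * h x = 0 ∧ ∃ x ∈ tsupport h, u x ≠ 0 := by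
  obtain ⟨c, -, hc⟩ := exists_integral_sub_mul_abs_sub_rpow_eq_zero hp hD.le
    hh.1.integrable.intervalIntegrable fun x _ => hh.1.nonneg x
  have hLip : LipschitzWith 1 fun x : ℝ => x - c :=
    LipschitzWith.of_dist_le_mul fun x y => by simp [Real.dist_eq]
  refine ⟨fun x => x - c, ⟨1, hLip⟩, integrable_mul_density hh
    (hLip.continuous.abs.rpow_const fun _ => Or.inr (by linarith)).continuousOn,
    by rwa [integral_mul_density hD.le hh], ?_⟩
  rw [hh.2]
  by_cases hcz : c = 0
  · exact ⟨D, right_mem_Icc.2 hD.le, by simp [hcz, hD.ne']⟩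
  · exact ⟨0, left_mem_Icc.2 hD.le, by simpa using hcz⟩

lemma integral_abs_rpow_mul_density_pos (hK : K ≤ 0) (hN : 1 < N) (hD : 0 < D)
    (hh : h ∈ densityClass K N D) (hu : Continuous u)
    (hint : Integrable fun x => |u x| ^ p * h x) (hne : ∃ x ∈ tsupport h, u x ≠ 0) :
    0 < ∫ x, |u x| ^ p * h x := by
  obtain ⟨z, hz, huz⟩ := hne
  rw [integral_pos_iff_support_of_nonneg
    (fun x => mul_nonneg (by positivity) (hh.1.nonneg x)) hint]
  have hopen : IsOpen {x | u x ≠ 0} := isOpen_ne_fun hu continuous_const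
  rw [hh.2, ← closure_Ioo hD.ne] at hz
  refine ((hopen.inter isOpen_Ioo).measure_pos volume
    (mem_closure_iff.1 hz _ hopen huz)).trans_le (measure_mono fun x hx => ?_)
  exact (mul_pos (Real.rpow_pos_of_pos (abs_pos.2 hx.1) p) (density_pos hK hN hh hx.2)).ne'

lemma integral_abs_rpow_le_integral_abs_sub_rpow (hp : 1 < p) (hab : a ≤ b)
    (hk : IntervalIntegrable k volume a b) (hk0 : ∀ x ∈ Icc a b, 0 ≤ k x) (hu : Continuous u)
    (hmean : ∫ x in a..b, u x * |u x| ^ (p - 2) * k x = 0) (c : ℝ) :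
    ∫ x in a..b, |u x| ^ p * k x ≤ ∫ x in a..b, |u x - c| ^ p * k x := by
  have hp0 : 0 ≤ p := by linarith
  have hshift : IntervalIntegrable (fun x => |u x - c| ^ p * k x) volume a b :=
    intervalIntegrable_abs_rpow_mul hp0 (hu.sub continuous_const) hk
  have hdual : IntervalIntegrable (fun x => u x * |u x| ^ (p - 2) * k x) volume a b :=
    hk.continuousOn_mul ((continuous_mul_abs_rpow hp).comp hu).continuousOn
  calc ∫ x in a..b, |u x| ^ p * k x
      ≤ ∫ x in a..b, (|u x - c| ^ p * k x + p * c * (u x * |u x| ^ (p - 2) * k x)) := by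
        refine intervalIntegral.integral_mono_on hab (intervalIntegrable_abs_rpow_mul hp0 hu hk)
          (hshift.add (hdual.const_mul _)) fun x hx => ?_
        linarith [mul_le_mul_of_nonneg_right (abs_rpow_le_abs_sub_rpow_add hp (u x) c) (hk0 x hx)]
    _ = ∫ x in a..b, |u x - c| ^ p * k x := by
        rw [intervalIntegral.integral_add hshift (hdual.const_mul _),
          intervalIntegral.integral_const_mul, hmean, mul_zero, add_zero]

lemma HalfPoincare.anti (ha : 0 ≤ a) (hk : ∀ x ∈ Ioo 0 a, 0 ≤ k x) (hμ : μ' ≤ μ)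
    (h : HalfPoincare p a μ k) : HalfPoincare p a μ' k := fun u hu hua =>
  (mul_le_mul_of_nonneg_right hμ (intervalIntegral_nonneg_of_Ioo ha fun x hx =>
    mul_nonneg (by positivity) (hk x hx))).trans (h u hu hua)

lemma HalfPoincare.le_integral_right (h : HalfPoincare p (D - a) μ fun x => k (D - x))
    (hu : LipschitzWith C u) (hua : u a = 0) :
    μ * ∫ x in a..D, |u x| ^ p * k x ≤ ∫ x in a..D, |deriv u x| ^ p * k x := by
  have hreflect := h (fun x => u (D - x)) ⟨C, LipschitzWith.of_dist_le_mul fun x y => by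
    simpa only [dist_sub_left] using hu.dist_le_mul (D - x) (D - y)⟩ (by simpa using hua)
  have hswap : ∀ g : ℝ → ℝ, ∫ x in (0 : ℝ)..(D - a), g (D - x) = ∫ x in a..D, g x := fun g => by
    rw [intervalIntegral.integral_comp_sub_left, sub_sub_cancel, sub_zero]
  simpa only [deriv_comp_const_sub, abs_neg, hswap fun x => |u x| ^ p * k x,
    hswap fun x => |deriv u x| ^ p * k x] using hreflect

lemma mul_integral_le_of_split (hp : 1 < p) (hD : 0 ≤ D)
    (hk : ∀ a b, IntervalIntegrable k volume a b) (hk0 : ∀ x ∈ Icc 0 D, 0 ≤ k x) (hμ : 0 ≤ μ)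
    (hl : HalfPoincare p a μ k) (hr : HalfPoincare p (D - a) μ fun x => k (D - x))
    (hu : LipschitzWith C u)
    (hmean : ∫ x in (0 : ℝ)..D, u x * |u x| ^ (p - 2) * k x = 0) :
    μ * ∫ x in (0 : ℝ)..D, |u x| ^ p * k x ≤ ∫ x in (0 : ℝ)..D, |deriv u x| ^ p * k x := by
  have hp0 : 0 ≤ p := by linarith
  set w : ℝ → ℝ := fun x => u x - u a with hw
  have hwa : w a = 0 := sub_self _
  have hwL : LipschitzWith C w := LipschitzWith.of_dist_le_mul fun x y => by
    simpa only [hw, dist_sub_right] using hu.dist_le_mul x y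
  have hwd : deriv w = deriv u := funext fun x => deriv_sub_const _
  calc μ * ∫ x in (0 : ℝ)..D, |u x| ^ p * k x
      ≤ μ * ∫ x in (0 : ℝ)..D, |w x| ^ p * k x := mul_le_mul_of_nonneg_left
        (integral_abs_rpow_le_integral_abs_sub_rpow hp hD (hk 0 D) hk0 hu.continuous hmean _) hμ
    _ = μ * (∫ x in (0 : ℝ)..a, |w x| ^ p * k x) + μ * ∫ x in a..D, |w x| ^ p * k x := by
        have hint := fun a b => intervalIntegrable_abs_rpow_mul hp0 hwL.continuous (hk a b)
        rw [← mul_add, intervalIntegral.integral_add_adjacent_intervals (hint 0 a) (hint a D)]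
    _ ≤ (∫ x in (0 : ℝ)..a, |deriv w x| ^ p * k x) + ∫ x in a..D, |deriv w x| ^ p * k x :=
        add_le_add (hl w ⟨C, hwL⟩ hwa) (hr.le_integral_right hwL hwa)
    _ = ∫ x in (0 : ℝ)..D, |deriv u x| ^ p * k x := by
        have hint := fun a b => intervalIntegrable_abs_deriv_rpow_mul hp0 hu (hk a b)
        rw [hwd, intervalIntegral.integral_add_adjacent_intervals (hint 0 a) (hint a D)]

lemma le_spectralGap (hp : 1 < p) (hK : K ≤ 0) (hN : 1 < N) (hD : 0 < D)
    (hh : h ∈ densityClass K N D) (hμ : 0 ≤ μ) (hl : HalfPoincare p a μ h)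
    (hr : HalfPoincare p (D - a) μ fun x => h (D - x)) : μ ≤ spectralGap p h := by
  obtain ⟨v, hvL, hvi, hv0, hvne⟩ := exists_admissible hp hD hh
  refine le_csInf ⟨_, v, hvL, hvi, hv0, hvne, rfl⟩ ?_
  rintro r ⟨u, ⟨C, hu⟩, hui, hu0, hune, rfl⟩
  rw [le_div_iff₀ (integral_abs_rpow_mul_density_pos hK hN hD hh hu.continuous hui hune)]
  simp only [integral_mul_density hD.le hh] at hu0 ⊢
  exact mul_integral_le_of_split hp hD.le (fun _ _ => hh.1.integrable.intervalIntegrable)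
    (fun x _ => hh.1.nonneg x) hμ hl hr hu hu0

end SpectralGap

/-! ### Rigidity -/

section Rigidity

variable {p K N D lam c c' τ τ' : ℝ} {h k f : ℝ → ℝ}

namespace IsMCPWeight

lemma exists_split_of_gain (hk : IsMCPWeight K N D k) (hp : 1 < p) (hK : K ≤ 0) (hN : 1 < N)
    (hlam : 0 < lam) (hf : IsModelEigenfunction p K N D lam f) (hτ : 0 < τ) (hττ' : τ < τ')
    (hτ' : τ' < D / 2) (hlt : k τ / leftModel K N D τ < k τ' / leftModel K N D τ') :
    ∃ a μ, lam < μ ∧ HalfPoincare p a μ k ∧ HalfPoincare p (D - a) μ fun x => k (D - x) := by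
  have hD : 0 < D := by linarith
  obtain ⟨μ, hμ, hhalf⟩ := exists_halfPoincare_of_gain hp hK hN hlam hf hk hτ hττ' hτ' hlt
  obtain ⟨a, ⟨haD', haD⟩, μ₁, hμ₁, hlonger⟩ :=
    hk.exists_longer_halfPoincare (by linarith) hK hN hD hlam.le hμ hhalf
  obtain ⟨μ₂, hμ₂, hshorter⟩ := exists_halfPoincare_of_lt hp hK hN hlam hf hk.reflect
    (sub_pos.2 haD) (by linarith)
  have hk0 : ∀ x ∈ Ioo 0 a, 0 ≤ k x := fun x hx => (hk.pos x ⟨hx.1, hx.2.trans haD⟩).le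
  have hr0 : ∀ x ∈ Ioo 0 (D - a), 0 ≤ k (D - x) := fun x hx =>
    (hk.reflect.pos x ⟨hx.1, by linarith [hx.2]⟩).le
  exact ⟨a, min μ₁ μ₂, lt_min hμ₁ hμ₂, hlonger.anti (by linarith) hk0 (min_le_left _ _),
    hshorter.anti (by linarith) hr0 (min_le_right _ _)⟩

lemma antitoneOn_div_leftModel (hk : IsMCPWeight K N D k) (hp : 1 < p) (hK : K ≤ 0) (hN : 1 < N)
    (hlam : 0 < lam) (hf : IsModelEigenfunction p K N D lam f)
    (hsplit : ∀ a μ, lam < μ → HalfPoincare p a μ k →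
      ¬HalfPoincare p (D - a) μ fun x => k (D - x)) :
    AntitoneOn (fun x => k x / leftModel K N D x) (Ioo 0 (D / 2)) := by
  intro τ hτ τ' hτ' hττ'
  rcases hττ'.eq_or_lt with rfl | hττ'
  · exact le_rfl
  by_contra! hlt
  obtain ⟨a, μ, hμ, hl, hr⟩ := hk.exists_split_of_gain hp hK hN hlam hf hτ.1 hττ' hτ'.2 hlt
  exact hsplit a μ hμ hl hr

lemma monotoneOn_div_leftModel (hk : IsMCPWeight K N D k) (hK : K ≤ 0) (hN : 1 < N) :
    MonotoneOn (fun x => k x / leftModel K N D x) (Ioo 0 D) := fun x hx y hy hxy =>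
  (div_le_div_iff₀ (leftModel_pos hK hN hx.2) (leftModel_pos hK hN hy.2)).2
    (hk.mono x y hx.1 hxy hy.2)

lemma eq_mul_leftModel (hk : IsMCPWeight K N D k) (hK : K ≤ 0) (hN : 1 < N) (hD : 0 < D)
    (hanti : AntitoneOn (fun x => k x / leftModel K N D x) (Ioo 0 (D / 2))) :
    ∃ c > 0, ∀ x ∈ Ioc 0 (D / 2), k x = c * leftModel K N D x := by
  set c := k (D / 4) / leftModel K N D (D / 4)
  have hquarter : D / 4 ∈ Ioo 0 (D / 2) := ⟨by linarith, by linarith⟩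
  have hsub : Ioo 0 (D / 2) ⊆ Ioo 0 D := Ioo_subset_Ioo_right (by linarith)
  have hmono := (hk.monotoneOn_div_leftModel hK hN).mono hsub
  have heq : EqOn k (fun x => c * leftModel K N D x) (Ioo 0 (D / 2)) := fun x hx => by
    refine (div_eq_iff (leftModel_pos hK hN (hsub hx).2).ne').1 ?_
    rcases le_total x (D / 4) with hle | hle
    · exact (hmono hx hquarter hle).antisymm (hanti hx hquarter hle)
    · exact (hanti hquarter hx hle).antisymm (hmono hquarter hx hle)
  refine ⟨c, div_pos (hk.pos _ (hsub hquarter)) (leftModel_pos hK hN (hsub hquarter).2),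
    heq.of_subset_closure (hk.continuousOn.mono fun x hx => ⟨hx.1, by linarith [hx.2]⟩)
      (continuous_const.mul (continuous_leftModel hN)).continuousOn Ioo_subset_Ioc_self ?_⟩
  rw [closure_Ioo (by linarith)]
  exact Ioc_subset_Icc_self

end IsMCPWeight

lemma eq_mul_modelDensity (hK : K ≤ 0) (hN : 1 < N) (hD : 0 < D)
    (hleft : ∀ x ∈ Ioc 0 (D / 2), h x = c * leftModel K N D x)
    (hright : ∀ x ∈ Ioc 0 (D / 2), h (D - x) = c' * leftModel K N D x) :
    ∀ x ∈ Ioo 0 D, h x = c * modelDensity K N D x := by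
  have hmid : D / 2 ∈ Ioc 0 (D / 2) := ⟨by linarith, le_rfl⟩
  have hc : c' = c := by
    have hmeet := hright _ hmid
    rw [sub_half, hleft _ hmid] at hmeet
    exact (mul_right_cancel₀ (leftModel_pos hK hN (by linarith)).ne' hmeet).symm
  intro x hx
  rw [modelDensity]
  split_ifs with hxl hxr
  · exact hleft x ⟨hx.1, hxl.2⟩
  · simpa only [leftModel, sub_sub_cancel, hc] using hright (D - x) ⟨by linarith [hx.2],
      by linarith [hxr.1]⟩
  · exact absurd (le_total x (D / 2)) (not_or.2 ⟨fun hle => hxl ⟨hx.1.le, hle⟩,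
      fun hle => hxr ⟨hle, hx.2.le⟩⟩)

end Rigidity

end MCPGap

theorem theorem3p11 (p K N D : ℝ) (hp : 1 < p) (hK : K ≤ 0) (hN : 1 < N) (hD : 0 < D)
    (h : ℝ → ℝ) (hh : h ∈ MCPGap.densityClass K N D)
    (hgap : MCPGap.spectralGap p h = MCPGap.modelGap p K N D) :
    ∃ c : ℝ, 0 < c ∧ ∀ x ∈ Set.Ioo 0 D, h x = c * MCPGap.modelDensity K N D x := by
  obtain ⟨lam, hlam, hφ, f, hf⟩ := MCPGap.exists_isModelEigenfunction hp hK hN hD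
  have hgap_le : MCPGap.spectralGap p h ≤ lam :=
    hgap.trans_le (csInf_le ⟨0, fun _ hr => hr.1⟩ ⟨hlam.le, hφ⟩)
  have hsplit : ∀ a μ, lam < μ → MCPGap.HalfPoincare p a μ h →
      ¬MCPGap.HalfPoincare p (D - a) μ fun x => h (D - x) := fun a μ hμ hl hr =>
    (hμ.trans_le (MCPGap.le_spectralGap hp hK hN hD hh (hlam.trans hμ).le hl hr)).not_ge hgap_le
  have hw := MCPGap.isMCPWeight_of_mem_densityClass hK hN hh
  obtain ⟨c, hc, hleft⟩ := hw.eq_mul_leftModel hK hN hD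
    (hw.antitoneOn_div_leftModel hp hK hN hlam hf hsplit)
  obtain ⟨c', -, hright⟩ := hw.reflect.eq_mul_leftModel hK hN hD
    (hw.reflect.antitoneOn_div_leftModel hp hK hN hlam hf fun a μ hμ hl hr =>
      hsplit (D - a) μ hμ (by simpa only [sub_sub_cancel] using hr)
        (by simpa only [sub_sub_cancel] using hl))
  exact ⟨c, hc, MCPGap.eq_mul_modelDensity hK hN hD hleft hright⟩
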